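/- Let $m,p\ge 0$ be integers, $\sigma>0$, ${\bf A}\in\mathbb R^{m\times m}$ with all eigenvalues in the open unit disc, ${\bf B}\in\mathbb R^{m\times p}$, ${\bf Q}\in\mathbb R^{p\times p}$ symmetric positive semidefinite, and let ${\bf C}_0\in\mathbb R^{m\times m}$ be symmetric positive semidefinite with ${\bf C}_0={\bf A}{\bf C}_0{\bf A}^T+{\bf B}{\bf Q}{\bf B}^T$. Consider the stationary vector Gauss–Markov signal $$\vec s_{i+1}={\bf A}\vec s_i+{\bf B}\vec u_i,\qquad \vec s_1\sim\mathcal N(0,{\bf C}_0),\qquad \vec u_i\overset{\text{i.i.d.}}{\sim}\mathcal N(0,{\bf Q}),$$ and i.i.d. measurement noise $\vec w_i\sim\mathcal N(0,\sigma^2{\bf I}_m)$, where $\vec s_1$, $(\vec u_i)$ and $(\vec w_i)$ are independent, and the hypotheses $$H_0:\ \vec y_i=\vec w_i,\qquad H_1:\ \vec y_i=\vec s_i+\vec w_i,\qquad i=1,\dots,N .$$ For $\alpha\in(0,1)$ let $P_M^*(N,\alpha)$ be the infimum of the miss probability $P_M$ (the probability under $H_1$ of deciding $H_0$) over all, possibly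 randomized, tests based on $\vec y_1,\dots,\vec y_N$ whose false alarm probability satisfies $P_F\le\alpha$. For a symmetric matrix ${\bf P}$ put ${\bf R}_e=\sigma^2{\bf I}_m+{\bf P}$ and ${\bf K}_p={\bf A}{\bf P}{\bf R}_e^{-1}$. Let $\vec e_i=\vec y_i-\mathbb E_{H_1}[\vec y_i\mid \vec y_1,\dots,\vec y_{i-1}]$, as a function of the observations, be the innovation process. Then: 1. The discrete-time Riccati equation $${\bf P}={\bf A}{\bf P}{\bf A}^T+{\bf B}{\bf Q}{\bf B}^T-{\bf A}{\bf P}{\bf R}_e^{-1}{\bf P}{\bf A}^T$$ has a unique stabilizing solution (a symmetric solution ${\bf P}$ with ${\bf R}_e$ invertible and all eigenvalues of ${\bf A}-{\bf K}_p$ in the open unit disc), and it is positive semidefinite. From now on ${\bf P}$, ${\bf R}_e$, ${\bf K}_p$ refer to this solution. 2. The Lyapunov equation $\tilde{\bf P}=({\bf A}-{\bf K}_p)\tilde{\bf P}({\bf A}-{\bf K}_p)^T+{\bf K}_p{\bf K}_p^T$ has a unique positive semidefinite solution $\tilde{\bf P}$; put $\tilde{\bf R}_e=\sigma^2({\bf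 I}_m+\tilde{\bf P})$. 3. As $i\to\infty$, the covariance matrix of $\vec e_i$ converges to ${\bf R}_e$ under $H_1$ and to $\tilde{\bf R}_e$ under $H_0$. 4. For every $\alpha\in(0,1)$, $P_M^*(N,\alpha)>0$ for all $N$, and the best error exponent of the miss probability per vector observation is $$\lim_{N\to\infty}-\frac1N\log P_M^*(N,\alpha)=K_v=-\frac12\log\frac{\sigma^{2m}}{\det{\bf R}_e}+\frac12\operatorname{tr}\left({\bf R}_e^{-1}\tilde{\bf R}_e\right)-\frac m2,$$ independently of $\alpha$. -/

import Mathlib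

open MeasureTheory ProbabilityTheory Filter Topology

noncomputable section

/-- The data of the vector model: `s_{i+1} = A s_i + B u_i` with `s_1 ∼ N(0, C₀)`,
`u_i` i.i.d. `N(0, Q)`, and measurement noise `w_i` i.i.d. `N(0, σ² I)`. -/
structure VectorModel (m p : ℕ) where
  A : Matrix (Fin m) (Fin m) ℝ
  B : Matrix (Fin m) (Fin p) ℝ
  Q : Matrix (Fin p) (Fin p) ℝ
  C₀ : Matrix (Fin m) (Fin m) ℝ
  σ : ℝ

/-- All complex eigenvalues of the real matrix `F` lie in the open unit disc. -/
def IsStableMatrix {m : ℕ} (F : Matrix (Fin m) (Fin m) ℝ) : Prop :=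
  ∀ z ∈ spectrum ℂ (F.map (algebraMap ℝ ℂ)), ‖z‖ < 1

namespace VectorModel

variable {m p : ℕ} (M : VectorModel m p)

/-- The signal path driven by the initial state `s₁` and the input `u`. Time is indexed from `0`. -/
def signal (s₁ : EuclideanSpace ℝ (Fin m)) (u : ℕ → EuclideanSpace ℝ (Fin p)) :
    ℕ → EuclideanSpace ℝ (Fin m)
  | 0 => s₁
  | i + 1 => Matrix.toEuclideanLin M.A (signal s₁ u i) + Matrix.toEuclideanLin M.B (u i)

/-- The law of the measurement noise sequence. -/
def noiseLaw : Measure (ℕ → EuclideanSpace ℝ (Fin m)) :=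
  Measure.infinitePi fun _ => multivariateGaussian 0 (M.σ ^ 2 • (1 : Matrix (Fin m) (Fin m) ℝ))

/-- The law of the input sequence. -/
def inputLaw : Measure (ℕ → EuclideanSpace ℝ (Fin p)) :=
  Measure.infinitePi fun _ => multivariateGaussian 0 M.Q

/-- The law of the observations under `H₀ : y_i = w_i`. -/
def lawH0 : Measure (ℕ → EuclideanSpace ℝ (Fin m)) := M.noiseLaw

/-- The law of the observations under `H₁ : y_i = s_i + w_i`; the initial state, the input and the
measurement noise are independent. -/
def lawH1 : Measure (ℕ → EuclideanSpace ℝ (Fin m)) :=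
  ((multivariateGaussian 0 M.C₀).prod (M.inputLaw.prod M.noiseLaw)).map
    fun ω i => M.signal ω.1 ω.2.1 i + ω.2.2 i

/-- A (possibly randomized) test based on `N` vector observations: `φ y` is the probability of
deciding for `H₁` when `y` is observed. -/
def IsTest {m N : ℕ} (φ : (Fin N → EuclideanSpace ℝ (Fin m)) → ℝ) : Prop :=
  Measurable φ ∧ ∀ y, φ y ∈ Set.Icc (0 : ℝ) 1

/-- The false alarm probability `P_F` of a test. -/
def falseAlarmProb {N : ℕ} (φ : (Fin N → EuclideanSpace ℝ (Fin m)) → ℝ) : ℝ :=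
  ∫ y, φ (fun i : Fin N => y i) ∂M.lawH0

/-- The miss probability `P_M` of a test. -/
def missProb {N : ℕ} (φ : (Fin N → EuclideanSpace ℝ (Fin m)) → ℝ) : ℝ :=
  ∫ y, (1 - φ (fun i : Fin N => y i)) ∂M.lawH1

/-- The least miss probability among the tests with `N` vector observations and level `α`. -/
def optimalMissProb (α : ℝ) (N : ℕ) : ℝ :=
  sInf {β | ∃ φ : (Fin N → EuclideanSpace ℝ (Fin m)) → ℝ,
    IsTest φ ∧ M.falseAlarmProb φ ≤ α ∧ M.missProb φ = β}

/-- The σ-algebra generated by the observations before time `i`. -/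
abbrev past (m i : ℕ) : MeasurableSpace (ℕ → EuclideanSpace ℝ (Fin m)) :=
  MeasurableSpace.comap (fun y (j : Fin i) => y j) inferInstance

/-- The innovation at time `i`: the observation minus its conditional mean under `H₁` given the
earlier observations, as a function of the observation path. -/
def innovation (i : ℕ) (y : ℕ → EuclideanSpace ℝ (Fin m)) : EuclideanSpace ℝ (Fin m) :=
  y i - (M.lawH1[fun y => y i | past m i]) y

/-- The covariance matrix of the innovation at time `i` when the observations have law `μ`. -/
def innovationCov (μ : Measure (ℕ → EuclideanSpace ℝ (Fin m))) (i : ℕ) :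
    Matrix (Fin m) (Fin m) ℝ :=
  Matrix.of fun a b => cov[fun y => M.innovation i y a, fun y => M.innovation i y b; μ]

/-- `R_e = σ² I + P`. -/
def Re (P : Matrix (Fin m) (Fin m) ℝ) : Matrix (Fin m) (Fin m) ℝ :=
  M.σ ^ 2 • (1 : Matrix (Fin m) (Fin m) ℝ) + P

/-- `K_p = A P R_e⁻¹`. -/
def Kp (P : Matrix (Fin m) (Fin m) ℝ) : Matrix (Fin m) (Fin m) ℝ :=
  M.A * P * (M.Re P)⁻¹

/-- `P` is a stabilizing solution of the discrete-time algebraic Riccati equation: a symmetric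
solution for which `A - K_p` is stable. -/
structure IsStabilizingSolution (P : Matrix (Fin m) (Fin m) ℝ) : Prop where
  symm : P.IsSymm
  isUnit_det : IsUnit (M.Re P).det
  riccati : P = M.A * P * M.A.transpose + M.B * M.Q * M.B.transpose
    - M.A * P * (M.Re P)⁻¹ * P * M.A.transpose
  stable : IsStableMatrix (M.A - M.Kp P)

/-- `P'` is a positive semidefinite solution of the Lyapunov equation
`P' = (A - K_p) P' (A - K_p)ᵀ + K_p K_pᵀ`. -/
structure IsLyapunovSolution (P P' : Matrix (Fin m) (Fin m) ℝ) : Prop where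
  posSemidef : P'.PosSemidef
  lyapunov : P' = (M.A - M.Kp P) * P' * (M.A - M.Kp P).transpose + M.Kp P * (M.Kp P).transpose

/-- `R̃_e = σ² (I + P')`. -/
def ReTilde (P' : Matrix (Fin m) (Fin m) ℝ) : Matrix (Fin m) (Fin m) ℝ :=
  M.σ ^ 2 • ((1 : Matrix (Fin m) (Fin m) ℝ) + P')

/-- `K_v = -½ log (σ^{2m} / det R_e) + ½ tr (R_e⁻¹ R̃_e) - m/2`. -/
def errorExponent (P P' : Matrix (Fin m) (Fin m) ℝ) : ℝ :=
  -(1 / 2) * Real.log (M.σ ^ (2 * m) / (M.Re P).det)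
    + 1 / 2 * ((M.Re P)⁻¹ * M.ReTilde P').trace - (m : ℝ) / 2

end VectorModel

end

/-!
Under `H₁` the Kalman filter writes the observations as a causal linear image of standard white
noise. That this image has the right Gaussian law is checked on quadratic forms: the Riccati
recursion is exactly what is needed to complete the square. Hence the innovation covariances under
`H₁` are `R_e` along the Riccati sequence, while under `H₀` the predictor is driven by pure noise
and its covariance follows a Lyapunov recursion with the closed-loop matrix.

Read in the normalized innovation coordinates, the log-likelihood ratio under `H₀` is a quadratic
form in a standard Gaussian vector. Its mean is the sum of the exponents along the recursions, and
its variance is `O(N)` because whitening is a contraction, so by Chebyshev's inequality the ratio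
concentrates at its mean per observation. Stein's lemma turns this into the error exponent. Finally,
the Riccati sequence started at `C₀` is antitone, hence converges; its limit stabilizes the closed
loop, which makes the Lyapunov recursion converge too.
-/

noncomputable section

section LinearRecursion

theorem tendsto_zero_of_le_mul_add {a ρ e : ℕ → ℝ} {r : ℝ} (ha : ∀ i, 0 ≤ a i)
    (h : ∀ i, a (i + 1) ≤ ρ i * a i + e i) (hρ : Tendsto ρ atTop (𝓝 r)) (hr : r < 1)
    (he : Tendsto e atTop (𝓝 0)) : Tendsto a atTop (𝓝 0) := by
  obtain ⟨q, hq, hq1⟩ := exists_between (max_lt hr (zero_lt_one' ℝ))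
  have hq0 : 0 < q := (le_max_right _ _).trans_lt hq
  have hρq : ∀ᶠ i in atTop, ρ i < q := hρ.eventually_lt_const ((le_max_left _ _).trans_lt hq)
  rw [Metric.tendsto_atTop]
  intro ε hε
  have hε' : 0 < ε / 2 * (1 - q) := mul_pos (half_pos hε) (sub_pos.2 hq1)
  obtain ⟨N, hN⟩ := eventually_atTop.1 (hρq.and (he.eventually_lt_const hε'))
  have geometric_bound : ∀ k, a (N + k) ≤ q ^ k * a N + ε / 2 := by
    intro k
    induction k with
    | zero => simpa using (half_pos hε).le
    | succ k ih =>
      obtain ⟨hρk, hek⟩ := hN (N + k) (Nat.le_add_right N k)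
      calc a (N + (k + 1)) ≤ ρ (N + k) * a (N + k) + e (N + k) := h (N + k)
        _ ≤ q * a (N + k) + ε / 2 * (1 - q) := by
            gcongr
            exact ha _
        _ ≤ q * (q ^ k * a N + ε / 2) + ε / 2 * (1 - q) := by gcongr
        _ = q ^ (k + 1) * a N + ε / 2 := by ring
  have hgeom : Tendsto (fun k => q ^ k * a N) atTop (𝓝 0) := by
    simpa using (tendsto_pow_atTop_nhds_zero_of_lt_one hq0.le hq1).mul_const (a N)
  obtain ⟨k₀, hk₀⟩ := eventually_atTop.1 (hgeom.eventually_lt_const (half_pos hε))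
  refine ⟨N + k₀, fun n hn => ?_⟩
  obtain ⟨k, rfl⟩ := Nat.exists_eq_add_of_le (le_of_add_le_left hn)
  rw [Real.dist_0_eq_abs, abs_of_nonneg (ha _)]
  linarith [geometric_bound k, hk₀ k (Nat.le_of_add_le_add_left hn)]

variable {𝕜 X : Type*} [NontriviallyNormedField 𝕜] [NormedAddCommGroup X] [NormedSpace 𝕜 X]

theorem exists_seminorm_map_le_mul {T : X →L[𝕜] X}
    (hT : Tendsto (fun n : ℕ => T ^ n) atTop (𝓝 0)) :
    ∃ (V : Seminorm 𝕜 X) (C r : ℝ), 0 ≤ C ∧ r < 1 ∧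
      (∀ x, ‖x‖ ≤ V x) ∧ (∀ x, V x ≤ C * ‖x‖) ∧ ∀ x, V (T x) ≤ r * V x := by
  obtain ⟨n, hTn, hn⟩ : ∃ n : ℕ, ‖T ^ n‖ < 1 ∧ n ≠ 0 :=
    (((tendsto_zero_iff_norm_tendsto_zero.1 hT).eventually_lt_const one_pos).and
      (eventually_ne_atTop 0)).exists
  let V : Seminorm 𝕜 X := ∑ k ∈ Finset.range n, (normSeminorm 𝕜 X).comp (T ^ k).toLinearMap
  have hV : ∀ x, V x = ∑ k ∈ Finset.range n, ‖(T ^ k) x‖ := fun x => by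
    rw [← FunLike.coeAddMonoidHom_apply, map_sum, Finset.sum_apply]
    rfl
  let C : ℝ := 1 + ∑ k ∈ Finset.range n, ‖T ^ k‖
  have hC : 0 < C := add_pos_of_pos_of_nonneg one_pos (Finset.sum_nonneg fun k _ => norm_nonneg _)
  have hVC : ∀ x, V x ≤ C * ‖x‖ := fun x => by
    have h : V x ≤ (∑ k ∈ Finset.range n, ‖T ^ k‖) * ‖x‖ := by
      rw [hV, Finset.sum_mul]
      gcongr with k
      exact (T ^ k).le_opNorm x
    linarith [norm_nonneg x, add_mul 1 (∑ k ∈ Finset.range n, ‖T ^ k‖) ‖x‖]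
  refine ⟨V, C, 1 - (1 - ‖T ^ n‖) / C, hC.le, sub_lt_self _ (div_pos (sub_pos.2 hTn) hC),
    fun x => ?_, hVC, fun x => ?_⟩
  · rw [hV]
    exact Finset.single_le_sum (f := fun k => ‖(T ^ k) x‖) (fun k _ => norm_nonneg _)
      (Finset.mem_range.2 (Nat.pos_of_ne_zero hn))
  · have hshift : V (T x) = V x - ‖x‖ + ‖(T ^ n) x‖ := by
      have h := (Finset.sum_range_succ' (fun k => ‖(T ^ k) x‖) n).symm.trans
        (Finset.sum_range_succ _ n)
      simp only [hV, pow_succ, pow_zero, mul_apply_eq_comp,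
        one_apply_eq_self] at h ⊢
      linarith
    calc V (T x) ≤ V x - (1 - ‖T ^ n‖) * ‖x‖ := by
          rw [hshift]
          linarith [(T ^ n).le_opNorm x]
      _ ≤ V x - (1 - ‖T ^ n‖) * (V x / C) := by
          have := sub_pos.2 hTn
          gcongr
          exact (div_le_iff₀' hC).2 (hVC x)
      _ = (1 - (1 - ‖T ^ n‖) / C) * V x := by ring

theorem tendsto_zero_of_linear_recursion {T : X →L[𝕜] X}
    (hT : Tendsto (fun n : ℕ => T ^ n) atTop (𝓝 0)) {T' : ℕ → X →L[𝕜] X}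
    (hT' : Tendsto T' atTop (𝓝 T)) {x e : ℕ → X} (hx : ∀ i, x (i + 1) = T' i (x i) + e i)
    (he : Tendsto e atTop (𝓝 0)) : Tendsto x atTop (𝓝 0) := by
  obtain ⟨V, C, r, hC, hr, hV, hVC, hVT⟩ := exists_seminorm_map_le_mul hT
  have hVx : Tendsto (fun i => V (x i)) atTop (𝓝 0) := by
    refine tendsto_zero_of_le_mul_add (ρ := fun i => r + C * ‖T' i - T‖)
      (e := fun i => C * ‖e i‖) (r := r) (fun i => apply_nonneg V _) (fun i => ?_) ?_ hr ?_
    · calc V (x (i + 1)) = V (T (x i) + (T' i - T) (x i) + e i) := by simp [hx i]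
        _ ≤ V (T (x i)) + V ((T' i - T) (x i)) + V (e i) :=
            (map_add_le_add V _ _).trans (by gcongr; exact map_add_le_add V _ _)
        _ ≤ r * V (x i) + C * (‖T' i - T‖ * V (x i)) + C * ‖e i‖ := by
            gcongr
            · exact hVT _
            · refine (hVC _).trans ?_
              gcongr
              exact ((T' i - T).le_opNorm _).trans (by gcongr; exact hV _)
            · exact hVC _
        _ = (r + C * ‖T' i - T‖) * V (x i) + C * ‖e i‖ := by ring
    · simpa using ((tendsto_iff_norm_sub_tendsto_zero.1 hT').const_mul C).const_add r
    · simpa using he.norm.const_mul C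
  exact squeeze_zero_norm (fun i => hV _) hVx

end LinearRecursion

section SteinEquation

theorem eq_zero_of_eq_mul_mul {R : Type*} [Ring R] [TopologicalSpace R] [ContinuousMul R]
    [T2Space R] {F G X : R} (hF : Tendsto (fun n : ℕ => F ^ n) atTop (𝓝 0))
    (hG : Tendsto (fun n : ℕ => G ^ n) atTop (𝓝 0)) (hX : X = F * X * G) : X = 0 := by
  have hpow : ∀ n : ℕ, X = F ^ n * X * G ^ n := by
    intro n
    induction n with
    | zero => simp
    | succ n ih =>
      calc X = F ^ n * X * G ^ n := ih
        _ = F ^ n * (F * X * G) * G ^ n := by rw [← hX]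
        _ = F ^ (n + 1) * X * G ^ (n + 1) := by simp only [pow_succ F, pow_succ' G, mul_assoc]
  have hlim : Tendsto (fun n : ℕ => F ^ n * X * G ^ n) atTop (𝓝 0) := by
    simpa using (hF.mul_const X).mul hG
  exact tendsto_nhds_unique (tendsto_const_nhds.congr hpow) hlim

theorem mulLeftRight_pow {𝕜 R : Type*} [NontriviallyNormedField 𝕜] [NormedRing R]
    [NormedAlgebra 𝕜 R] (F G : R) (n : ℕ) :
    ContinuousLinearMap.mulLeftRight 𝕜 R F G ^ n
      = ContinuousLinearMap.mulLeftRight 𝕜 R (F ^ n) (G ^ n) := by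
  ext1 Y
  induction n with
  | zero => simp
  | succ n ih =>
    rw [pow_succ', mul_apply_eq_comp, ih]
    simp only [ContinuousLinearMap.mulLeftRight_apply, pow_succ' F, pow_succ G, mul_assoc]

theorem tendsto_of_stein_recursion (𝕜 : Type*) {R : Type*} [NontriviallyNormedField 𝕜]
    [NormedRing R] [NormedAlgebra 𝕜 R] {F G X N : R}
    (hF : Tendsto (fun n : ℕ => F ^ n) atTop (𝓝 0)) (hG : Tendsto (fun n : ℕ => G ^ n) atTop (𝓝 0))
    (hX : X = F * X * G + N) {F' G' N' S : ℕ → R} (hF' : Tendsto F' atTop (𝓝 F))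
    (hG' : Tendsto G' atTop (𝓝 G)) (hN' : Tendsto N' atTop (𝓝 N))
    (hS : ∀ i, S (i + 1) = F' i * S i * G' i + N' i) : Tendsto S atTop (𝓝 X) := by
  obtain ⟨T, hT⟩ : ∃ T, T = ContinuousLinearMap.mulLeftRight 𝕜 R := ⟨_, rfl⟩
  have hT_tendsto : ∀ {F G : R} {F' G' : ℕ → R}, Tendsto F' atTop (𝓝 F) →
      Tendsto G' atTop (𝓝 G) → Tendsto (fun i => T (F' i) (G' i)) atTop (𝓝 (T F G)) :=
    fun hF' hG' => (T.continuous₂.tendsto (_, _)).comp (hF'.prodMk_nhds hG')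
  have hT_pow : Tendsto (fun n : ℕ => (T F G) ^ n) atTop (𝓝 0) := by
    have hpow : ∀ n : ℕ, (T F G) ^ n = T (F ^ n) (G ^ n) :=
      hT ▸ mulLeftRight_pow F G
    simp only [hpow]
    simpa only [map_zero] using hT_tendsto hF hG
  have hforcing : Tendsto (fun i => F' i * X * G' i + N' i - X) atTop (𝓝 0) := by
    have h := (((hF'.mul_const X).mul hG').add hN').sub_const X
    rwa [← hX, sub_self] at h
  refine tendsto_sub_nhds_zero_iff.1 (tendsto_zero_of_linear_recursion hT_pow
    (hT_tendsto hF' hG') (fun i => ?_) hforcing)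
  simp only [hT, ContinuousLinearMap.mulLeftRight_apply, hS]
  noncomm_ring

end SteinEquation

theorem tendsto_pow_zero_of_spectralRadius_lt_one {A : Type*} [NormedRing A] [NormedAlgebra ℂ A]
    [CompleteSpace A] {a : A} (ha : spectralRadius ℂ a < 1) :
    Tendsto (fun n : ℕ => a ^ n) atTop (𝓝 0) := by
  obtain ⟨r, hr, hr1⟩ := ENNReal.lt_iff_exists_nnreal_btwn.1 ha
  have gelfand :=
    (spectrum.pow_nnnorm_pow_one_div_tendsto_nhds_spectralRadius a).eventually_lt_const hr
  refine squeeze_zero_norm' ?_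
    (tendsto_pow_atTop_nhds_zero_of_lt_one r.2 (by exact_mod_cast hr1))
  filter_upwards [gelfand, eventually_gt_atTop 0] with n hn hn0
  have h := ENNReal.rpow_le_rpow hn.le (Nat.cast_nonneg' n)
  rw [← ENNReal.rpow_mul, one_div, inv_mul_cancel₀ (by positivity), ENNReal.rpow_one,
    ENNReal.rpow_natCast] at h
  exact_mod_cast h

section LoewnerOrder

open scoped MatrixOrder ComplexOrder Matrix

variable {n : Type*}

theorem posSemidef_of_tendsto [Finite n] {𝕜 ι : Type*} [RCLike 𝕜] {l : Filter ι} [l.NeBot]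
    {P : ι → Matrix n n 𝕜} {X : Matrix n n 𝕜} (hP : ∀ i, (P i).PosSemidef)
    (hlim : Tendsto P l (𝓝 X)) : X.PosSemidef := by
  have := Fintype.ofFinite n
  refine .of_dotProduct_mulVec_nonneg ?_ fun x => ?_
  · have hstar : Tendsto (fun i => (P i)ᴴ) l (𝓝 Xᴴ) :=
      (continuous_id.matrix_conjTranspose.tendsto _).comp hlim
    exact tendsto_nhds_unique hstar (hlim.congr fun i => (hP i).1.symm)
  · have hcont : Continuous fun Y : Matrix n n 𝕜 => star x ⬝ᵥ Y *ᵥ x := by fun_prop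
    exact ge_of_tendsto' ((hcont.tendsto _).comp hlim) fun i =>
      (hP i).dotProduct_mulVec_nonneg x

theorem apply_eq_polarization [Fintype n] [DecidableEq n] {P : Matrix n n ℝ} (hP : P.IsSymm)
    (a b : n) :
    P a b = ((Pi.single a 1 + Pi.single b 1 : n → ℝ) ⬝ᵥ P *ᵥ (Pi.single a 1 + Pi.single b 1)
      - (Pi.single a 1 : n → ℝ) ⬝ᵥ P *ᵥ Pi.single a 1
      - (Pi.single b 1 : n → ℝ) ⬝ᵥ P *ᵥ Pi.single b 1) / 2 := by
  simp only [Matrix.mulVec_add, dotProduct_add, add_dotProduct, Matrix.mulVec_single_one,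
    single_one_dotProduct, Matrix.col_apply, hP.apply a b]
  ring

theorem exists_tendsto_of_antitone_of_nonneg [Finite n] {P : ℕ → Matrix n n ℝ}
    (hanti : Antitone P) (hP : ∀ i, 0 ≤ P i) : ∃ X : Matrix n n ℝ, Tendsto P atTop (𝓝 X) := by
  classical
  have := Fintype.ofFinite n
  have hquad : ∀ x : n → ℝ, ∃ l, Tendsto (fun i => x ⬝ᵥ P i *ᵥ x) atTop (𝓝 l) := by
    intro x
    refine ⟨_, tendsto_atTop_ciInf (fun i j hij => ?_) ⟨0, ?_⟩⟩
    · simpa [Matrix.sub_mulVec, dotProduct_sub] using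
        (Matrix.le_iff.1 (hanti hij)).dotProduct_mulVec_nonneg x
    · rintro _ ⟨i, rfl⟩
      simpa using (Matrix.nonneg_iff_posSemidef.1 (hP i)).dotProduct_mulVec_nonneg x
  choose l hl using hquad
  refine ⟨Matrix.of fun a b =>
    (l (Pi.single a 1 + Pi.single b 1) - l (Pi.single a 1) - l (Pi.single b 1)) / 2,
    tendsto_pi_nhds.2 fun a => tendsto_pi_nhds.2 fun b => ?_⟩
  have hsymm : ∀ i, (P i).IsSymm := fun i => (Matrix.nonneg_iff_posSemidef.1 (hP i)).1
  exact ((((hl _).sub (hl _)).sub (hl _)).div_const 2).congr fun i =>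
    (apply_eq_polarization (hsymm i) a b).symm

theorem transpose_map_ofReal {k l : Type*} (N : Matrix k l ℝ) :
    Nᵀ.map (algebraMap ℝ ℂ) = (N.map (algebraMap ℝ ℂ))ᴴ := by
  ext
  simp

theorem posSemidef_map_ofReal [Finite n] {P : Matrix n n ℝ} (hP : P.PosSemidef) :
    (P.map (algebraMap ℝ ℂ)).PosSemidef := by
  classical
  have := Fintype.ofFinite n
  obtain ⟨S, rfl⟩ := CStarAlgebra.nonneg_iff_eq_star_mul_self.1 hP.nonneg
  rw [Matrix.star_eq_conjTranspose, Matrix.conjTranspose_eq_transpose_of_trivial, Matrix.map_mul,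
    transpose_map_ofReal]
  exact Matrix.posSemidef_conjTranspose_mul_self _

variable [Fintype n] [DecidableEq n]

/- `S - R` and `R⁻¹ - S⁻¹` are the two Schur complements of the block matrix `[S, 1; 1, R⁻¹]`. -/
theorem inv_le_inv_of_posDef {𝕜 : Type*} [RCLike 𝕜] {R S : Matrix n n 𝕜} (hR : R.PosDef)
    (hRS : R ≤ S) : S⁻¹ ≤ R⁻¹ := by
  have hS : S.PosDef := by simpa using hR.add_posSemidef (Matrix.le_iff.1 hRS)
  have := hS.isUnit.invertible
  have := hR.inv.isUnit.invertible
  have hblock := (Matrix.PosDef.fromBlocks₂₂ S 1 hR.inv).2 (by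
    simpa [Matrix.nonsing_inv_nonsing_inv _ ((Matrix.isUnit_iff_isUnit_det _).1 hR.isUnit)]
      using Matrix.le_iff.1 hRS)
  simpa [Matrix.le_iff] using (Matrix.PosDef.fromBlocks₁₁ 1 R⁻¹ hS).1 hblock

theorem mem_spectrum_iff_exists_vecMul {K : Type*} [Field K] {F : Matrix n n K} {z : K} :
    z ∈ spectrum K F ↔ ∃ v ≠ 0, v ᵥ* F = z • v := by
  rw [spectrum.mem_iff, Matrix.isUnit_iff_isUnit_det, isUnit_iff_ne_zero, not_not,
    ← Matrix.exists_vecMul_eq_zero_iff]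
  simp only [Matrix.vecMul_sub, Algebra.algebraMap_eq_smul_one, Matrix.vecMul_smul,
    Matrix.vecMul_one, sub_eq_zero, eq_comm]

/- If `v F = z v` with `1 ≤ ‖z‖`, the inequality evaluated at `v` reads
`‖z‖² (v X v*) + ‖v K‖² ≤ v X v*`, so `v K = 0` and `v (F + K L) = z v`. -/
theorem mem_spectrum_add_mul_of_lyapunov_le {k : Type*} [Fintype k] {F X : Matrix n n ℂ}
    {K : Matrix n k ℂ} (hX : 0 ≤ X) (h : F * X * Fᴴ + K * Kᴴ ≤ X) (L : Matrix k n ℂ) {z : ℂ}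
    (hz : z ∈ spectrum ℂ F) (hz1 : 1 ≤ ‖z‖) : z ∈ spectrum ℂ (F + K * L) := by
  obtain ⟨v, hv0, hv⟩ := mem_spectrum_iff_exists_vecMul.1 hz
  have hX_nonneg : 0 ≤ v ⬝ᵥ X *ᵥ star v := by
    simpa using (Matrix.nonneg_iff_posSemidef.1 hX).dotProduct_mulVec_nonneg (star v)
  have hF_quad : v ⬝ᵥ (F * X * Fᴴ) *ᵥ star v = z * star z * (v ⬝ᵥ X *ᵥ star v) := by
    rw [← Matrix.mulVec_mulVec, ← Matrix.mulVec_mulVec, Matrix.dotProduct_mulVec v F,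
      ← Matrix.star_vecMul, hv, star_smul, Matrix.mulVec_smul, smul_dotProduct, dotProduct_smul,
      smul_smul, smul_eq_mul]
  have hK_quad : v ⬝ᵥ (K * Kᴴ) *ᵥ star v = (v ᵥ* K) ⬝ᵥ star (v ᵥ* K) := by
    rw [← Matrix.mulVec_mulVec, Matrix.dotProduct_mulVec v K, Matrix.star_vecMul]
  have hle : z * star z * (v ⬝ᵥ X *ᵥ star v) + (v ᵥ* K) ⬝ᵥ star (v ᵥ* K)
      ≤ v ⬝ᵥ X *ᵥ star v := by
    have hdefect := (Matrix.le_iff.1 h).dotProduct_mulVec_nonneg (star v)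
    rwa [star_star, Matrix.sub_mulVec, Matrix.add_mulVec, dotProduct_sub, dotProduct_add, hF_quad,
      hK_quad, sub_nonneg] at hdefect
  have hzz : 1 ≤ z * star z := by
    rw [Complex.star_def, Complex.mul_conj']
    exact_mod_cast one_le_pow₀ hz1
  have hvK : v ᵥ* K = 0 :=
    dotProduct_self_star_eq_zero.1 <| le_antisymm
      ((add_le_iff_nonpos_right _).1
        ((add_le_add_left (le_mul_of_one_le_left hX_nonneg hzz) _).trans hle))
      (dotProduct_self_star_nonneg _)
  refine mem_spectrum_iff_exists_vecMul.2 ⟨v, hv0, ?_⟩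
  rw [Matrix.vecMul_add, hv, ← Matrix.vecMul_vecMul, hvK, Matrix.zero_vecMul, add_zero]

end LoewnerOrder

section StableMatrix

namespace IsStableMatrix

open scoped Matrix

variable {m : ℕ} {F G N X : Matrix (Fin m) (Fin m) ℝ}

theorem tendsto_pow (hF : IsStableMatrix F) : Tendsto (fun n : ℕ => F ^ n) atTop (𝓝 0) := by
  rcases isEmpty_or_nonempty (Fin m) with hm | hm
  · exact tendsto_const_nhds.congr fun n => Subsingleton.elim _ _
  let _ := Matrix.linftyOpNormedRing (n := Fin m) (α := ℂ)
  let _ := Matrix.linftyOpNormedAlgebra (R := ℂ) (n := Fin m) (α := ℂ)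
  have hradius : spectralRadius ℂ (F.map (algebraMap ℝ ℂ)) < 1 :=
    spectrum.spectralRadius_lt_of_forall_lt _ (r := 1) fun z hz => by exact_mod_cast hF z hz
  have hlim := tendsto_pow_zero_of_spectralRadius_lt_one hradius
  have hpow : ∀ n : ℕ, F ^ n = (F.map (algebraMap ℝ ℂ) ^ n).map Complex.re := fun n => by
    rw [← RingHom.mapMatrix_apply, ← map_pow]
    ext
    simp
  simp only [hpow]
  exact ((continuous_id.matrix_map Complex.continuous_re).tendsto' _ _ (by ext; simp)).comp hlim

theorem transpose (hF : IsStableMatrix F) : IsStableMatrix Fᵀ := by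
  intro z hz
  refine hF z ?_
  rw [spectrum.mem_iff] at hz ⊢
  rwa [← Matrix.isUnit_transpose, Matrix.transpose_sub, Matrix.algebraMap_eq_diagonal,
    Matrix.diagonal_transpose, ← Matrix.algebraMap_eq_diagonal]

theorem eq_zero_of_eq_mul_mul_transpose (hF : IsStableMatrix F) (hG : IsStableMatrix G)
    (hX : X = F * X * Gᵀ) : X = 0 :=
  eq_zero_of_eq_mul_mul hF.tendsto_pow hG.transpose.tendsto_pow hX

theorem exists_stein (hF : IsStableMatrix F) (hG : IsStableMatrix G)
    (N : Matrix (Fin m) (Fin m) ℝ) : ∃ X, X = F * X * Gᵀ + N := by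
  let T : Matrix (Fin m) (Fin m) ℝ →ₗ[ℝ] Matrix (Fin m) (Fin m) ℝ :=
    LinearMap.id - LinearMap.mulLeftRight ℝ (F, Gᵀ)
  have hT : ∀ X, T X = X - F * X * Gᵀ := fun X => by simp [T]
  have hinj : Function.Injective T := by
    rw [← LinearMap.ker_eq_bot, LinearMap.ker_eq_bot']
    intro X hX
    rw [hT, sub_eq_zero] at hX
    exact hF.eq_zero_of_eq_mul_mul_transpose hG hX
  obtain ⟨X, hX⟩ := LinearMap.injective_iff_surjective.1 hinj N
  exact ⟨X, by rw [← hX, hT]; abel⟩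

theorem tendsto_lyapunov (hF : IsStableMatrix F) (hX : X = F * X * Fᵀ + N)
    {F' N' S : ℕ → Matrix (Fin m) (Fin m) ℝ} (hF' : Tendsto F' atTop (𝓝 F))
    (hN' : Tendsto N' atTop (𝓝 N)) (hS : ∀ i, S (i + 1) = F' i * S i * (F' i)ᵀ + N' i) :
    Tendsto S atTop (𝓝 X) := by
  let _ := Matrix.linftyOpNormedRing (n := Fin m) (α := ℝ)
  let _ := Matrix.linftyOpNormedAlgebra (R := ℝ) (n := Fin m) (α := ℝ)
  have hFt' : Tendsto (fun i => (F' i)ᵀ) atTop (𝓝 Fᵀ) :=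
    (continuous_id.matrix_transpose.tendsto _).comp hF'
  exact tendsto_of_stein_recursion ℝ hF.tendsto_pow hF.transpose.tendsto_pow hX hF' hFt' hN' hS

theorem posSemidef_of_lyapunov (hF : IsStableMatrix F) (hN : N.PosSemidef)
    (hX : X = F * X * Fᵀ + N) : X.PosSemidef := by
  let S : ℕ → Matrix (Fin m) (Fin m) ℝ := fun n => (fun Y => F * Y * Fᵀ + N)^[n] 0
  have hS : ∀ n, S (n + 1) = F * S n * Fᵀ + N := fun n => Function.iterate_succ_apply' _ n 0
  have hS_nonneg : ∀ n, (S n).PosSemidef := by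
    intro n
    induction n with
    | zero => exact Matrix.PosSemidef.zero
    | succ n ih => simpa [hS] using (ih.mul_mul_conjTranspose_same F).add hN
  exact posSemidef_of_tendsto hS_nonneg
    (hF.tendsto_lyapunov hX tendsto_const_nhds tendsto_const_nhds hS)

open scoped MatrixOrder ComplexOrder in
theorem of_add_mul {k : Type*} [Fintype k] {K : Matrix (Fin m) k ℝ} {L : Matrix k (Fin m) ℝ}
    (hFL : IsStableMatrix (F + K * L)) (hX : X.PosSemidef) (h : F * X * Fᵀ + K * Kᵀ ≤ X) :
    IsStableMatrix F := by
  intro z hz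
  by_contra! hz1
  refine (hFL z ?_).not_ge hz1
  rw [Matrix.map_add _ (map_add _), Matrix.map_mul]
  refine mem_spectrum_add_mul_of_lyapunov_le (posSemidef_map_ofReal hX).nonneg ?_ _ hz hz1
  have hdefect := posSemidef_map_ofReal (Matrix.le_iff.1 h)
  rw [Matrix.map_sub _ (map_sub _), Matrix.map_add _ (map_add _), Matrix.map_mul, Matrix.map_mul,
    Matrix.map_mul, transpose_map_ofReal, transpose_map_ofReal] at hdefect
  exact Matrix.le_iff.2 hdefect

end IsStableMatrix

end StableMatrix

section Riccati

open scoped Matrix MatrixOrder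

namespace VectorModel

variable {m p : ℕ} (M : VectorModel m p)

/-- One step of the Riccati recursion for the prediction error covariance of the Kalman filter. -/
def riccatiStep (P : Matrix (Fin m) (Fin m) ℝ) : Matrix (Fin m) (Fin m) ℝ :=
  M.A * P * M.Aᵀ + M.B * M.Q * M.Bᵀ - M.A * P * (M.Re P)⁻¹ * P * M.Aᵀ

/-- The prediction error covariances of the Kalman filter started from the stationary law. -/
def riccatiSeq : ℕ → Matrix (Fin m) (Fin m) ℝ
  | 0 => M.C₀
  | i + 1 => M.riccatiStep (riccatiSeq i)

variable {M} {P X : Matrix (Fin m) (Fin m) ℝ}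

theorem posDef_Re (hσ : 0 < M.σ) (hP : P.PosSemidef) : (M.Re P).PosDef :=
  (Matrix.PosDef.one.smul (pow_pos hσ 2)).add_posSemidef hP

theorem isUnit_det_Re (hσ : 0 < M.σ) (hP : P.PosSemidef) : IsUnit (M.Re P).det :=
  (Matrix.isUnit_iff_isUnit_det _).1 (posDef_Re hσ hP).isUnit

theorem mul_inv_Re (h : IsUnit (M.Re P).det) : P * (M.Re P)⁻¹ = 1 - M.σ ^ 2 • (M.Re P)⁻¹ := by
  rw [eq_sub_iff_add_eq']
  calc M.σ ^ 2 • (M.Re P)⁻¹ + P * (M.Re P)⁻¹ = M.Re P * (M.Re P)⁻¹ := by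
        simp only [Re, add_mul, smul_mul_assoc, one_mul]
    _ = 1 := Matrix.mul_nonsing_inv _ h

theorem inv_Re_mul (h : IsUnit (M.Re P).det) : (M.Re P)⁻¹ * P = 1 - M.σ ^ 2 • (M.Re P)⁻¹ := by
  rw [eq_sub_iff_add_eq']
  calc M.σ ^ 2 • (M.Re P)⁻¹ + (M.Re P)⁻¹ * P = (M.Re P)⁻¹ * M.Re P := by
        simp only [Re, mul_add, mul_smul_comm, mul_one]
    _ = 1 := Matrix.nonsing_inv_mul _ h

theorem transpose_inv_Re (hP : P.IsSymm) : ((M.Re P)⁻¹)ᵀ = (M.Re P)⁻¹ := by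
  simp [Matrix.transpose_nonsing_inv, Re, hP.eq]

theorem sub_Kp (h : IsUnit (M.Re P).det) : M.A - M.Kp P = M.σ ^ 2 • (M.A * (M.Re P)⁻¹) := by
  rw [Kp, mul_assoc, mul_inv_Re h, mul_sub, mul_one, mul_smul_comm, sub_sub_cancel]

theorem transpose_sub_Kp (h : IsUnit (M.Re P).det) (hP : P.IsSymm) :
    (M.A - M.Kp P)ᵀ = M.σ ^ 2 • ((M.Re P)⁻¹ * M.Aᵀ) := by
  rw [sub_Kp h, Matrix.transpose_smul, Matrix.transpose_mul, transpose_inv_Re hP]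

theorem sub_Kp_mul (h : IsUnit (M.Re P).det) : (M.A - M.Kp P) * P = M.σ ^ 2 • M.Kp P := by
  rw [sub_Kp h, Kp, smul_mul_assoc, mul_assoc, mul_assoc, inv_Re_mul h, mul_inv_Re h]

theorem riccatiStep_eq_sub_Kp_mul (P : Matrix (Fin m) (Fin m) ℝ) :
    M.riccatiStep P = (M.A - M.Kp P) * P * M.Aᵀ + M.B * M.Q * M.Bᵀ := by
  rw [riccatiStep, sub_mul, sub_mul, Kp]
  abel

theorem riccatiStep_eq_joseph (h : IsUnit (M.Re P).det) :
    M.riccatiStep P = (M.A - M.Kp P) * P * (M.A - M.Kp P)ᵀ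
      + M.B * M.Q * M.Bᵀ + M.σ ^ 2 • (M.Kp P * (M.Kp P)ᵀ) := by
  rw [riccatiStep_eq_sub_Kp_mul, Matrix.transpose_sub, mul_sub, sub_Kp_mul h,
    ← smul_mul_assoc]
  abel

theorem riccatiStep_eq (h : IsUnit (M.Re P).det) :
    M.riccatiStep P = M.B * M.Q * M.Bᵀ + M.σ ^ 2 • (M.A * M.Aᵀ)
      - M.σ ^ 4 • (M.A * (M.Re P)⁻¹ * M.Aᵀ) := by
  rw [riccatiStep_eq_sub_Kp_mul, sub_Kp_mul h, Kp, mul_assoc M.A, mul_inv_Re h]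
  simp only [mul_sub, sub_mul, mul_one, mul_smul_comm, smul_mul_assoc, smul_sub, smul_smul]
  module

theorem riccatiStep_sub (hP : IsUnit (M.Re P).det) (hX : IsUnit (M.Re X).det) (hXs : X.IsSymm) :
    M.riccatiStep P - M.riccatiStep X = (M.A - M.Kp P) * (P - X) * (M.A - M.Kp X)ᵀ := by
  have hsub : P - X = M.Re P - M.Re X := by simp [Re]
  have hinv_sub : (M.Re X)⁻¹ - (M.Re P)⁻¹ = (M.Re P)⁻¹ * (P - X) * (M.Re X)⁻¹ := by
    rw [hsub, mul_sub, sub_mul, Matrix.nonsing_inv_mul _ hP, one_mul, mul_assoc,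
      Matrix.mul_nonsing_inv _ hX, mul_one]
  calc M.riccatiStep P - M.riccatiStep X
      = M.σ ^ 4 • (M.A * ((M.Re X)⁻¹ - (M.Re P)⁻¹) * M.Aᵀ) := by
        rw [riccatiStep_eq hP, riccatiStep_eq hX, mul_sub, sub_mul, smul_sub]
        abel
    _ = (M.A - M.Kp P) * (P - X) * (M.A - M.Kp X)ᵀ := by
        rw [hinv_sub, sub_Kp hP, transpose_sub_Kp hX hXs]
        simp only [smul_mul_assoc, mul_smul_comm, smul_smul, mul_assoc, ← pow_add]

theorem posSemidef_riccatiStep (hσ : 0 < M.σ) (hQ : M.Q.PosSemidef) (hP : P.PosSemidef) :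
    (M.riccatiStep P).PosSemidef := by
  rw [riccatiStep_eq_joseph (isUnit_det_Re hσ hP)]
  exact ((hP.mul_mul_conjTranspose_same (M.A - M.Kp P)).add
    (hQ.mul_mul_conjTranspose_same M.B)).add
    ((Matrix.posSemidef_self_mul_conjTranspose (M.Kp P)).smul (sq_nonneg M.σ))

theorem riccatiStep_mono (hσ : 0 < M.σ) (hX : X.PosSemidef) (hXP : X ≤ P) :
    M.riccatiStep X ≤ M.riccatiStep P := by
  have hP : P.PosSemidef := Matrix.nonneg_iff_posSemidef.1 (hX.nonneg.trans hXP)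
  have hinv : (M.Re P)⁻¹ ≤ (M.Re X)⁻¹ :=
    inv_le_inv_of_posDef (posDef_Re hσ hX) (add_le_add_right hXP _)
  have hconj := (Matrix.le_iff.1 hinv).mul_mul_conjTranspose_same M.A
  rw [riccatiStep_eq (isUnit_det_Re hσ hP), riccatiStep_eq (isUnit_det_Re hσ hX)]
  refine sub_le_sub_left (smul_le_smul_of_nonneg_left ?_ (by positivity)) _
  rwa [Matrix.le_iff, ← sub_mul, ← mul_sub]

theorem posSemidef_riccatiSeq (hσ : 0 < M.σ) (hQ : M.Q.PosSemidef) (hC₀ : M.C₀.PosSemidef) :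
    ∀ i, (M.riccatiSeq i).PosSemidef
  | 0 => hC₀
  | i + 1 => posSemidef_riccatiStep hσ hQ (posSemidef_riccatiSeq hσ hQ hC₀ i)

theorem riccatiStep_le_of_lyapunov (hσ : 0 < M.σ) (hP : P.PosSemidef)
    (h : P = M.A * P * M.Aᵀ + M.B * M.Q * M.Bᵀ) : M.riccatiStep P ≤ P := by
  have hgain := (posDef_Re hσ hP).inv.posSemidef.mul_mul_conjTranspose_same (M.A * P)
  rw [Matrix.conjTranspose_mul, hP.1.eq, Matrix.conjTranspose_eq_transpose_of_trivial,
    ← mul_assoc] at hgain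
  rw [Matrix.le_iff]
  nth_rw 1 [h]
  rwa [riccatiStep, sub_sub_cancel]

theorem riccatiSeq_antitone (hσ : 0 < M.σ) (hQ : M.Q.PosSemidef) (hC₀ : M.C₀.PosSemidef)
    (hstat : M.C₀ = M.A * M.C₀ * M.Aᵀ + M.B * M.Q * M.Bᵀ) : Antitone M.riccatiSeq := by
  refine antitone_nat_of_succ_le fun i => ?_
  induction i with
  | zero => exact riccatiStep_le_of_lyapunov hσ hC₀ hstat
  | succ i ih => exact riccatiStep_mono hσ (posSemidef_riccatiSeq hσ hQ hC₀ _) ih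

theorem tendsto_inv_Re {P' : ℕ → Matrix (Fin m) (Fin m) ℝ} (hP : IsUnit (M.Re P).det)
    (h : Tendsto P' atTop (𝓝 P)) :
    Tendsto (fun i => (M.Re (P' i))⁻¹) atTop (𝓝 (M.Re P)⁻¹) := by
  have hRe : Tendsto (fun i => M.Re (P' i)) atTop (𝓝 (M.Re P)) := h.const_add _
  have hdet := (continuous_id.matrix_det.tendsto _).comp hRe
  have hadj := (continuous_id.matrix_adjugate.tendsto _).comp hRe
  simp only [Matrix.inv_def, Ring.inverse_eq_inv']
  exact (hdet.inv₀ hP.ne_zero).smul hadj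

theorem tendsto_Kp {P' : ℕ → Matrix (Fin m) (Fin m) ℝ} (hP : IsUnit (M.Re P).det)
    (h : Tendsto P' atTop (𝓝 P)) : Tendsto (fun i => M.Kp (P' i)) atTop (𝓝 (M.Kp P)) :=
  (h.const_mul M.A).mul (tendsto_inv_Re hP h)

theorem exists_tendsto_riccatiSeq (hσ : 0 < M.σ) (hQ : M.Q.PosSemidef) (hC₀ : M.C₀.PosSemidef)
    (hstat : M.C₀ = M.A * M.C₀ * M.Aᵀ + M.B * M.Q * M.Bᵀ) :
    ∃ P, Tendsto M.riccatiSeq atTop (𝓝 P) ∧ P.PosSemidef ∧ P = M.riccatiStep P := by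
  obtain ⟨P, hlim⟩ := exists_tendsto_of_antitone_of_nonneg (riccatiSeq_antitone hσ hQ hC₀ hstat)
    fun i => (posSemidef_riccatiSeq hσ hQ hC₀ i).nonneg
  have hP := posSemidef_of_tendsto (posSemidef_riccatiSeq hσ hQ hC₀) hlim
  have hinv := tendsto_inv_Re (isUnit_det_Re hσ hP) hlim
  have hstep : Tendsto (fun i => M.riccatiStep (M.riccatiSeq i)) atTop (𝓝 (M.riccatiStep P)) :=
    (((hlim.const_mul M.A).mul_const _).add_const _).sub
      ((((hlim.const_mul M.A).mul hinv).mul hlim).mul_const _)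
  exact ⟨P, hlim, hP, tendsto_nhds_unique ((tendsto_add_atTop_iff_nat 1).2 hlim) hstep⟩

theorem isStableMatrix_sub_Kp (hσ : 0 < M.σ) (hQ : M.Q.PosSemidef) (hA : IsStableMatrix M.A)
    (hP : P.PosSemidef) (hfix : P = M.riccatiStep P) : IsStableMatrix (M.A - M.Kp P) := by
  refine .of_add_mul (X := P) (K := M.σ • M.Kp P) (L := M.σ⁻¹ • 1) ?_ hP ?_
  · simpa [smul_smul, hσ.ne'] using hA
  · have hdefect : M.riccatiStep P - ((M.A - M.Kp P) * P * (M.A - M.Kp P)ᵀ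
        + M.σ • M.Kp P * (M.σ • M.Kp P)ᵀ) = M.B * M.Q * M.Bᵀ := by
      rw [riccatiStep_eq_joseph (isUnit_det_Re hσ hP), Matrix.transpose_smul, smul_mul_smul_comm]
      module
    rw [Matrix.le_iff]
    nth_rw 1 [hfix]
    exact hdefect ▸ hQ.mul_mul_conjTranspose_same M.B

theorem isStabilizingSolution_of_posSemidef (hσ : 0 < M.σ) (hQ : M.Q.PosSemidef)
    (hA : IsStableMatrix M.A) (hP : P.PosSemidef) (hfix : P = M.riccatiStep P) :
    M.IsStabilizingSolution P where
  symm := hP.1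
  isUnit_det := isUnit_det_Re hσ hP
  riccati := hfix
  stable := isStableMatrix_sub_Kp hσ hQ hA hP hfix

theorem IsStabilizingSolution.eq (hP : M.IsStabilizingSolution P)
    (hX : M.IsStabilizingSolution X) : X = P := by
  have hsub : X - P = (M.A - M.Kp X) * (X - P) * (M.A - M.Kp P)ᵀ :=
    (congrArg₂ (· - ·) hX.riccati hP.riccati).trans
      (riccatiStep_sub hX.isUnit_det hP.isUnit_det hP.symm)
  exact sub_eq_zero.1 (hX.stable.eq_zero_of_eq_mul_mul_transpose hP.stable hsub)

theorem exists_isLyapunovSolution (hP : IsStableMatrix (M.A - M.Kp P)) :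
    ∃ P', M.IsLyapunovSolution P P' := by
  obtain ⟨P', hP'⟩ := hP.exists_stein hP (M.Kp P * (M.Kp P)ᵀ)
  exact ⟨P', hP.posSemidef_of_lyapunov (Matrix.posSemidef_self_mul_conjTranspose (M.Kp P)) hP',
    hP'⟩

theorem IsLyapunovSolution.eq {P' : Matrix (Fin m) (Fin m) ℝ}
    (hP : IsStableMatrix (M.A - M.Kp P)) (hP' : M.IsLyapunovSolution P P')
    (hX : M.IsLyapunovSolution P X) : X = P' := by
  refine sub_eq_zero.1 (hP.eq_zero_of_eq_mul_mul_transpose hP ?_)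
  nth_rw 1 [hX.lyapunov, hP'.lyapunov]
  noncomm_ring

end VectorModel

end Riccati

section Stein

/-- The least probability under `ν` of deciding for `μ`, among the randomized tests whose
probability under `μ` of deciding for `ν` is at most `α`. As in `VectorModel.IsTest`, `φ x` is the
probability of deciding for `ν` when `x` is observed. -/
def leastMissProb {X : Type*} [MeasurableSpace X] (μ ν : Measure X) (α : ℝ) : ℝ :=
  sInf {β | ∃ φ : X → ℝ, (Measurable φ ∧ ∀ x, φ x ∈ Set.Icc (0 : ℝ) 1) ∧
    ∫ x, φ x ∂μ ≤ α ∧ ∫ x, (1 - φ x) ∂ν = β}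

section Fixed

variable {X : Type*} [MeasurableSpace X] {μ ν : Measure X} {L : X → ℝ}

theorem integrable_exp_neg_of_withDensity [IsFiniteMeasure ν] (hL : Measurable L)
    (hν : ν = μ.withDensity fun x => ENNReal.ofReal (Real.exp (-L x))) :
    Integrable (fun x => Real.exp (-L x)) μ := by
  refine ⟨by fun_prop, ?_⟩
  rw [hasFiniteIntegral_iff_ofReal (ae_of_all _ fun x => (Real.exp_pos _).le), ← setLIntegral_univ,
    ← withDensity_apply _ MeasurableSet.univ, ← hν]
  exact measure_lt_top _ _

theorem integral_eq_integral_exp_neg_mul (hL : Measurable L)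
    (hν : ν = μ.withDensity fun x => ENNReal.ofReal (Real.exp (-L x))) (f : X → ℝ) :
    ∫ x, f x ∂ν = ∫ x, Real.exp (-L x) * f x ∂μ := by
  rw [hν, integral_withDensity_eq_integral_toReal_smul (by fun_prop)
    (ae_of_all _ fun x => ENNReal.ofReal_lt_top)]
  simp [ENNReal.toReal_ofReal (Real.exp_pos _).le]

variable [IsProbabilityMeasure μ]

theorem tendsto_measureReal_lt_atTop (hL : Measurable L) :
    Tendsto (fun c => μ.real {x | c < L x}) atTop (𝓝 0) := by
  have := Measure.isProbabilityMeasure_map (μ := μ) hL.aemeasurable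
  have hcdf := (tendsto_cdf_atTop (μ.map L)).const_sub 1
  rw [sub_self] at hcdf
  refine hcdf.congr fun c => ?_
  rw [cdf_eq_real, map_measureReal_apply hL measurableSet_Iic,
    ← probReal_compl_eq_one_sub (hL measurableSet_Iic)]
  congr 1
  ext x
  simp

theorem exp_neg_mul_le_integral_one_sub [IsFiniteMeasure ν] (hL : Measurable L)
    (hν : ν = μ.withDensity fun x => ENNReal.ofReal (Real.exp (-L x))) {φ : X → ℝ}
    (hφ : Measurable φ) (hφ01 : ∀ x, φ x ∈ Set.Icc (0 : ℝ) 1) (c : ℝ) :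
    Real.exp (-c) * (1 - ∫ x, φ x ∂μ - μ.real {x | c < L x}) ≤ ∫ x, (1 - φ x) ∂ν := by
  have hs : MeasurableSet {x | c < L x} := measurableSet_lt measurable_const hL
  have hφ_int : Integrable φ μ := .of_mem_Icc 0 1 hφ.aemeasurable (ae_of_all _ hφ01)
  have hsub_int : Integrable (fun x => 1 - φ x) μ := (integrable_const 1).sub hφ_int
  have hind_int : Integrable ({x | c < L x}.indicator fun _ => (1 : ℝ)) μ :=
    (integrable_const 1).indicator hs
  have hbound : ∀ x, ‖1 - φ x‖ ≤ 1 := fun x => by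
    rw [Real.norm_of_nonneg (sub_nonneg.2 (hφ01 x).2)]
    linarith [(hφ01 x).1]
  have hpointwise : ∀ x, Real.exp (-c) * (1 - φ x - {x | c < L x}.indicator (fun _ => (1 : ℝ)) x)
      ≤ Real.exp (-L x) * (1 - φ x) := fun x => by
    have hφx := sub_nonneg.2 (hφ01 x).2
    by_cases hx : c < L x
    · rw [Set.indicator_of_mem (by exact hx)]
      refine le_trans ?_ (mul_nonneg (Real.exp_pos _).le hφx)
      exact mul_nonpos_of_nonneg_of_nonpos (Real.exp_pos _).le (by linarith [(hφ01 x).1])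
    · rw [Set.indicator_of_notMem (by exact hx), sub_zero]
      gcongr
      exact not_lt.1 hx
  calc Real.exp (-c) * (1 - ∫ x, φ x ∂μ - μ.real {x | c < L x})
      = ∫ x, Real.exp (-c) * (1 - φ x - {x | c < L x}.indicator (fun _ => (1 : ℝ)) x) ∂μ := by
        rw [integral_const_mul, integral_sub hsub_int hind_int,
          integral_sub (integrable_const _) hφ_int, integral_indicator_const _ hs]
        simp
    _ ≤ ∫ x, Real.exp (-L x) * (1 - φ x) ∂μ :=
        integral_mono ((hsub_int.sub hind_int).const_mul _)
          ((integrable_exp_neg_of_withDensity hL hν).mul_bdd (by fun_prop) (ae_of_all _ hbound))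
          hpointwise
    _ = ∫ x, (1 - φ x) ∂ν := (integral_eq_integral_exp_neg_mul hL hν _).symm

theorem integral_one_sub_indicator_le (hL : Measurable L)
    (hν : ν = μ.withDensity fun x => ENNReal.ofReal (Real.exp (-L x))) (c : ℝ) :
    ∫ x, (1 - {x | L x < c}.indicator (fun _ => (1 : ℝ)) x) ∂ν ≤ Real.exp (-c) := by
  rw [integral_eq_integral_exp_neg_mul hL hν]
  calc _ ≤ ∫ _, Real.exp (-c) ∂μ := by
        refine integral_mono_of_nonneg (ae_of_all _ fun x => ?_) (integrable_const _)
          (ae_of_all _ fun x => ?_)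
        · refine mul_nonneg (Real.exp_pos _).le ?_
          simp only [Set.indicator_apply]
          split_ifs <;> simp
        · simp only [Set.indicator_apply, Set.mem_ofPred_eq]
          split_ifs with h
          · simpa using (Real.exp_pos _).le
          · simpa using h
    _ = Real.exp (-c) := by simp

theorem exp_neg_mul_le_leastMissProb [IsFiniteMeasure ν] (hL : Measurable L)
    (hν : ν = μ.withDensity fun x => ENNReal.ofReal (Real.exp (-L x))) {α : ℝ} (hα : 0 ≤ α)
    (c : ℝ) : Real.exp (-c) * (1 - α - μ.real {x | c < L x}) ≤ leastMissProb μ ν α := by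
  apply le_csInf
  · exact ⟨_, fun _ => 0, ⟨measurable_const, fun _ => by simp⟩, by simpa using hα, rfl⟩
  rintro β ⟨φ, ⟨hφ, hφ01⟩, hφα, rfl⟩
  refine le_trans ?_ (exp_neg_mul_le_integral_one_sub hL hν hφ hφ01 c)
  gcongr

theorem leastMissProb_le_exp_neg (hL : Measurable L)
    (hν : ν = μ.withDensity fun x => ENNReal.ofReal (Real.exp (-L x))) {α c : ℝ}
    (hc : μ.real {x | L x < c} ≤ α) : leastMissProb μ ν α ≤ Real.exp (-c) := by
  have hs : MeasurableSet {x | L x < c} := measurableSet_lt hL measurable_const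
  refine le_trans ?_ (integral_one_sub_indicator_le hL hν c)
  refine csInf_le ⟨0, ?_⟩ ⟨_, ⟨measurable_const.indicator hs, fun x => ?_⟩, ?_, rfl⟩
  · rintro β ⟨φ, ⟨-, hφ01⟩, -, rfl⟩
    exact integral_nonneg fun x => sub_nonneg.2 (hφ01 x).2
  · simp only [Set.indicator_apply]
    split_ifs <;> simp
  · rw [integral_indicator_const _ hs]
    simpa using hc

theorem leastMissProb_pos [IsFiniteMeasure ν] (hL : Measurable L)
    (hν : ν = μ.withDensity fun x => ENNReal.ofReal (Real.exp (-L x))) {α : ℝ}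
    (hα : α ∈ Set.Ioo (0 : ℝ) 1) : 0 < leastMissProb μ ν α := by
  obtain ⟨c, hc⟩ :=
    ((tendsto_measureReal_lt_atTop (μ := μ) hL).eventually_lt_const (sub_pos.2 hα.2)).exists
  exact (mul_pos (Real.exp_pos _) (sub_pos.2 hc)).trans_le
    (exp_neg_mul_le_leastMissProb hL hν hα.1.le c)

theorem neg_log_leastMissProb_mem_Icc [IsFiniteMeasure ν] (hL : Measurable L)
    (hν : ν = μ.withDensity fun x => ENNReal.ofReal (Real.exp (-L x))) {α : ℝ}
    (hα : α ∈ Set.Ioo (0 : ℝ) 1) {κ ε : ℝ}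
    (h : μ.real {x | ε ≤ |L x - κ|} ≤ min α ((1 - α) / 2)) :
    -Real.log (leastMissProb μ ν α) ∈ Set.Icc (κ - ε) (κ + ε - Real.log ((1 - α) / 2)) := by
  have hα' : 0 < (1 - α) / 2 := half_pos (sub_pos.2 hα.2)
  have hupper_tail : μ.real {x | κ + ε < L x} ≤ (1 - α) / 2 :=
    (measureReal_mono fun x (hx : κ + ε < L x) =>
      (le_sub_iff_add_le'.2 hx.le).trans (le_abs_self _)).trans (h.trans (min_le_right _ _))
  have hlower_tail : μ.real {x | L x < κ - ε} ≤ α :=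
    (measureReal_mono fun x (hx : L x < κ - ε) =>
      (show ε ≤ -(L x - κ) by linarith).trans (neg_le_abs _)).trans (h.trans (min_le_left _ _))
  have hle := Real.log_le_log (leastMissProb_pos hL hν hα)
    (leastMissProb_le_exp_neg hL hν hlower_tail)
  have hge := Real.log_le_log (mul_pos (Real.exp_pos _) hα')
    ((mul_le_mul_of_nonneg_left (by linarith) (Real.exp_pos _).le).trans
      (exp_neg_mul_le_leastMissProb hL hν hα.1.le (κ + ε)))
  rw [Real.log_exp] at hle
  rw [Real.log_mul (Real.exp_pos _).ne' hα'.ne', Real.log_exp] at hge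
  constructor <;> linarith

end Fixed

theorem tendsto_measureReal_mul_le_abs_sub {X : ℕ → Type*} [∀ N, MeasurableSpace (X N)]
    {μ : ∀ N, Measure (X N)} [∀ N, IsFiniteMeasure (μ N)] {L : ∀ N, X N → ℝ}
    (hL : ∀ N, MemLp (L N) 2 (μ N)) {κ D ε : ℝ}
    (hmean : Tendsto (fun N : ℕ => (N : ℝ)⁻¹ * ∫ x, L N x ∂μ N) atTop (𝓝 κ))
    (hvar : ∀ N : ℕ, Var[L N; μ N] ≤ N * D) (hε : 0 < ε) :
    Tendsto (fun N : ℕ => (μ N).real {x | N * ε ≤ |L N x - N * κ|}) atTop (𝓝 0) := by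
  have hbound : Tendsto (fun N : ℕ => D / (ε / 2) ^ 2 / (N : ℝ)) atTop (𝓝 0) :=
    tendsto_const_div_atTop_nhds_zero_nat _
  refine squeeze_zero' (Eventually.of_forall fun N => measureReal_nonneg) ?_ hbound
  filter_upwards [Metric.tendsto_nhds.1 hmean (ε / 2) (half_pos hε), eventually_gt_atTop 0]
    with N hN hN0
  have hNpos : (0 : ℝ) < N := by exact_mod_cast hN0
  have hbias : |∫ x, L N x ∂μ N - N * κ| ≤ N * (ε / 2) := by
    rw [← mul_inv_cancel_left₀ hNpos.ne' (∫ x, L N x ∂μ N), ← mul_sub, abs_mul,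
      abs_of_pos hNpos]
    exact mul_le_mul_of_nonneg_left hN.le hNpos.le
  calc (μ N).real {x | N * ε ≤ |L N x - N * κ|}
      ≤ (μ N).real {x | N * (ε / 2) ≤ |L N x - ∫ x, L N x ∂μ N|} :=
        measureReal_mono fun x (hx : N * ε ≤ |L N x - N * κ|) => by
          have htriangle := abs_sub_le (L N x) (∫ x, L N x ∂μ N) (N * κ)
          change N * (ε / 2) ≤ |L N x - ∫ x, L N x ∂μ N|
          linarith
    _ ≤ Var[L N; μ N] / (N * (ε / 2)) ^ 2 :=
        ENNReal.toReal_le_of_le_ofReal (div_nonneg (variance_nonneg _ _) (sq_nonneg _))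
          (meas_ge_le_variance_div_sq (hL N) (by positivity))
    _ ≤ N * D / (N * (ε / 2)) ^ 2 := by gcongr; exact hvar N
    _ = D / (ε / 2) ^ 2 / N := by field_simp

theorem tendsto_neg_log_leastMissProb {X : ℕ → Type*} [∀ N, MeasurableSpace (X N)]
    {μ ν : ∀ N, Measure (X N)} [∀ N, IsProbabilityMeasure (μ N)] [∀ N, IsFiniteMeasure (ν N)]
    {L : ∀ N, X N → ℝ} (hL : ∀ N, Measurable (L N))
    (hν : ∀ N, ν N = (μ N).withDensity fun x => ENNReal.ofReal (Real.exp (-L N x))) {κ : ℝ}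
    (hκ : ∀ ε > 0, Tendsto (fun N : ℕ => (μ N).real {x | N * ε ≤ |L N x - N * κ|}) atTop (𝓝 0))
    {α : ℝ} (hα : α ∈ Set.Ioo (0 : ℝ) 1) :
    Tendsto (fun N : ℕ => -(1 / (N : ℝ)) * Real.log (leastMissProb (μ N) (ν N) α)) atTop
      (𝓝 κ) := by
  rw [Metric.tendsto_atTop']
  intro ε hε
  have hprob := (hκ (ε / 2) (half_pos hε)).eventually_le_const (u := min α ((1 - α) / 2))
    (lt_min hα.1 (half_pos (sub_pos.2 hα.2)))
  have hconst := (tendsto_const_div_atTop_nhds_zero_nat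
    (-Real.log ((1 - α) / 2))).eventually_lt_const (half_pos hε)
  obtain ⟨N₀, hN₀⟩ := eventually_atTop.1 (hprob.and hconst)
  refine ⟨N₀, fun N hN => ?_⟩
  obtain ⟨hprobN, hconstN⟩ := hN₀ N hN.le
  have hN0 : (0 : ℝ) < N := by exact_mod_cast (Nat.zero_le N₀).trans_lt hN
  obtain ⟨hlower, hupper⟩ := neg_log_leastMissProb_mem_Icc (hL N) (hν N) hα hprobN
  rw [div_lt_iff₀' hN0] at hconstN
  rw [neg_mul, one_div_mul_eq_div, ← neg_div, Real.dist_eq, abs_sub_lt_iff,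
    sub_lt_iff_lt_add', sub_lt_comm, div_lt_iff₀' hN0, lt_div_iff₀' hN0]
  have hNε : 0 < N * ε := mul_pos hN0 hε
  constructor <;> linarith

end Stein

section StdGaussian

open scoped RealInnerProductSpace

variable {V : Type*} [NormedAddCommGroup V] [InnerProductSpace ℝ V] [FiniteDimensional ℝ V]

theorem exists_isSymmetric_inner_eq_half_norm_sq_sub (T : V →ₗ[ℝ] V) :
    ∃ S : V →ₗ[ℝ] V, S.IsSymmetric ∧ ∀ x, ⟪x, S x⟫ = (‖T x‖ ^ 2 - ‖x‖ ^ 2) / 2 := by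
  refine ⟨(1 / 2 : ℝ) • (LinearMap.adjoint T ∘ₗ T - LinearMap.id), fun x y => ?_, fun x => ?_⟩
  · simp only [LinearMap.smul_apply, real_inner_smul_left, real_inner_smul_right,
      LinearMap.sub_apply, inner_sub_left, inner_sub_right, LinearMap.comp_apply,
      LinearMap.adjoint_inner_left, LinearMap.adjoint_inner_right, LinearMap.id_apply]
  · simp only [LinearMap.smul_apply, real_inner_smul_right, LinearMap.sub_apply, inner_sub_right,
      LinearMap.comp_apply, LinearMap.adjoint_inner_right, LinearMap.id_apply,
      real_inner_self_eq_norm_sq]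
    ring

theorem inner_sum_eigenvectorBasis {S : V →ₗ[ℝ] V} (hS : S.IsSymmetric) {n : ℕ}
    (hn : Module.finrank ℝ V = n) (x : Fin n → ℝ) :
    ⟪∑ i, x i • hS.eigenvectorBasis hn i, S (∑ i, x i • hS.eigenvectorBasis hn i)⟫
      = ∑ i, hS.eigenvalues hn i * x i ^ 2 := by
  have hmap : S (∑ i, x i • hS.eigenvectorBasis hn i)
      = ∑ i, (hS.eigenvalues hn i * x i) • hS.eigenvectorBasis hn i := by
    rw [map_sum]
    refine Finset.sum_congr rfl fun i _ => ?_
    rw [map_smul, hS.apply_eigenvectorBasis, smul_smul, mul_comm]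
    rfl
  rw [hmap, (hS.eigenvectorBasis hn).orthonormal.inner_sum]
  refine Finset.sum_congr rfl fun i _ => ?_
  simp only [conj_trivial]
  ring

theorem abs_eigenvalues_le {S : V →ₗ[ℝ] V} (hS : S.IsSymmetric) {n : ℕ}
    (hn : Module.finrank ℝ V = n) {c : ℝ} (hc : ∀ x, |⟪x, S x⟫| ≤ c * ‖x‖ ^ 2) (i : Fin n) :
    |hS.eigenvalues hn i| ≤ c := by
  have hi := hc (hS.eigenvectorBasis hn i)
  rw [hS.apply_eigenvectorBasis, real_inner_smul_right, real_inner_self_eq_norm_sq,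
    (hS.eigenvectorBasis hn).norm_eq_one] at hi
  simpa using hi

variable [MeasurableSpace V] [BorelSpace V]

theorem integrable_exp_neg_half_norm_sq : Integrable fun x : V => Real.exp (-(‖x‖ ^ 2 / 2)) := by
  refine (GaussianFourier.integrable_cexp_neg_mul_sq_norm_add (V := V) (b := (1 / 2 : ℂ))
    (by norm_num) 0 0).re.congr (ae_of_all _ fun x => ?_)
  have hexp : (-(1 / 2 : ℂ) * ‖x‖ ^ 2 + 0 * (⟪(0 : V), x⟫ : ℝ))
      = ((-(‖x‖ ^ 2 / 2) : ℝ) : ℂ) := by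
    push_cast
    ring
  simp only [hexp, ← Complex.ofReal_exp]
  exact Complex.ofReal_re _

theorem integral_exp_neg_half_norm_sq_smul_cexp_inner (t : V) :
    ∫ x : V, Real.exp (-(‖x‖ ^ 2 / 2)) • Complex.exp ((⟪x, t⟫ : ℝ) * Complex.I)
      = (((2 * Real.pi) ^ (Module.finrank ℝ V / 2 : ℝ) : ℝ) : ℂ) * Complex.exp (-‖t‖ ^ 2 / 2) := by
  have hexp : ∀ x : V, Real.exp (-(‖x‖ ^ 2 / 2)) • Complex.exp ((⟪x, t⟫ : ℝ) * Complex.I)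
      = Complex.exp (-(1 / 2 : ℂ) * ‖x‖ ^ 2 + Complex.I * (⟪t, x⟫ : ℝ)) := fun x => by
    rw [Complex.real_smul, Complex.ofReal_exp, ← Complex.exp_add, real_inner_comm]
    push_cast
    ring_nf
  have hpi : ((Real.pi : ℂ) / (1 / 2)) ^ ((Module.finrank ℝ V : ℂ) / 2)
      = (((2 * Real.pi) ^ (Module.finrank ℝ V / 2 : ℝ) : ℝ) : ℂ) := by
    rw [Complex.ofReal_cpow (by positivity)]
    push_cast
    ring_nf
  simp_rw [hexp]
  rw [GaussianFourier.integral_cexp_neg_mul_sq_norm_add (by norm_num), hpi, Complex.I_sq]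
  ring_nf

theorem stdGaussian_eq_withDensity :
    stdGaussian V = volume.withDensity fun x => ENNReal.ofReal
      (((2 * Real.pi) ^ (Module.finrank ℝ V / 2 : ℝ))⁻¹ * Real.exp (-(‖x‖ ^ 2 / 2))) := by
  set c : ℝ := (2 * Real.pi) ^ (Module.finrank ℝ V / 2 : ℝ) with hc_def
  have hc : 0 < c := by positivity
  have hfinite : IsFiniteMeasure ((volume : Measure V).withDensity fun x => ENNReal.ofReal
      (c⁻¹ * Real.exp (-(‖x‖ ^ 2 / 2)))) :=
    isFiniteMeasure_withDensity_ofReal (integrable_exp_neg_half_norm_sq.const_mul _).2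
  refine Measure.ext_of_charFun (funext fun t => ?_)
  rw [charFun_stdGaussian, charFun_apply, integral_withDensity_eq_integral_toReal_smul
    (by fun_prop) (ae_of_all _ fun x => ENNReal.ofReal_lt_top)]
  have hdensity : ∀ x : V, (ENNReal.ofReal (c⁻¹ * Real.exp (-(‖x‖ ^ 2 / 2)))).toReal
      = c⁻¹ * Real.exp (-(‖x‖ ^ 2 / 2)) := fun x => ENNReal.toReal_ofReal (by positivity)
  simp_rw [hdensity, mul_smul]
  rw [integral_smul, integral_exp_neg_half_norm_sq_smul_cexp_inner, ← hc_def, Complex.real_smul,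
    Complex.ofReal_inv, inv_mul_cancel_left₀ (by exact_mod_cast hc.ne')]

theorem stdGaussian_map_linearMap {T W : V →ₗ[ℝ] V} (h : W * T = 1) :
    (stdGaussian V).map T = (stdGaussian V).withDensity fun x => ENNReal.ofReal
      (Real.exp (-(Real.log |LinearMap.det T| + (‖W x‖ ^ 2 - ‖x‖ ^ 2) / 2))) := by
  have hT : Measurable T := T.continuous_of_finiteDimensional.measurable
  have hW : Measurable W := W.continuous_of_finiteDimensional.measurable
  have hdet : LinearMap.det T ≠ 0 := fun h0 => by simpa [h0] using congrArg LinearMap.det h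
  set c := ((2 * Real.pi) ^ (Module.finrank ℝ V / 2 : ℝ))⁻¹ with hc_def
  have hc : 0 ≤ c := by positivity
  ext s hs
  rw [Measure.map_apply hT hs, stdGaussian_eq_withDensity, ← hc_def,
    ← withDensity_mul _ (by fun_prop) (by fun_prop),
    withDensity_apply _ (hT hs), withDensity_apply _ hs]
  calc ∫⁻ x in T ⁻¹' s, ENNReal.ofReal (c * Real.exp (-(‖x‖ ^ 2 / 2)))
      = ∫⁻ x in s, ENNReal.ofReal (c * Real.exp (-(‖W x‖ ^ 2 / 2)))
        ∂(Measure.map T volume) := by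
        rw [setLIntegral_map hs (by fun_prop) hT]
        simp only [← Module.End.mul_apply, h, Module.End.one_apply]
    _ = ∫⁻ x in s, ENNReal.ofReal |(LinearMap.det T)⁻¹|
          * ENNReal.ofReal (c * Real.exp (-(‖W x‖ ^ 2 / 2))) := by
        rw [Measure.map_linearMap_addHaar_eq_smul_addHaar _ hdet, Measure.restrict_smul,
          lintegral_smul_measure, smul_eq_mul, lintegral_const_mul _ (by fun_prop)]
    _ = _ := by
        refine lintegral_congr fun x => ?_
        rw [Pi.mul_apply, ← ENNReal.ofReal_mul (abs_nonneg _),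
          ← ENNReal.ofReal_mul (mul_nonneg hc (Real.exp_pos _).le), mul_assoc c, ← Real.exp_add,
          abs_inv, mul_left_comm, ← Real.exp_log (inv_pos.2 (abs_pos.2 hdet)), Real.log_inv,
          ← Real.exp_add]
        ring_nf

theorem memLp_sq_gaussianReal : MemLp (fun x : ℝ => x ^ 2) 2 (gaussianReal 0 1) := by
  rw [memLp_two_iff_integrable_sq (by fun_prop)]
  have hfourth := (memLp_id_gaussianReal (μ := 0) (v := 1) 4).integrable_norm_pow (by norm_num)
  refine hfourth.congr (ae_of_all _ fun x => ?_)
  simp only [id_eq, Real.norm_eq_abs, ← pow_mul]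
  exact Even.pow_abs (by decide) x

theorem memLp_inner_stdGaussian {S : V →ₗ[ℝ] V} (hS : S.IsSymmetric) :
    MemLp (fun x => ⟪x, S x⟫) 2 (stdGaussian V) := by
  rw [stdGaussian_eq_map_pi_orthonormalBasis (hS.eigenvectorBasis rfl),
    memLp_map_measure_iff (by fun_prop) (Measurable.aemeasurable (by fun_prop))]
  simp only [Function.comp_def, inner_sum_eigenvectorBasis]
  exact memLp_finsetSum _ fun i _ =>
    (memLp_sq_gaussianReal.const_mul _).comp_measurePreserving (measurePreserving_eval _ i)

theorem variance_inner_stdGaussian_le {S : V →ₗ[ℝ] V} (hS : S.IsSymmetric) {c : ℝ}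
    (hc : ∀ x, |⟪x, S x⟫| ≤ c * ‖x‖ ^ 2) :
    Var[fun x => ⟪x, S x⟫; stdGaussian V]
      ≤ Module.finrank ℝ V * (c ^ 2 * Var[fun x : ℝ => x ^ 2; gaussianReal 0 1]) := by
  have hS_meas : Measurable S := S.toContinuousLinearMap.continuous.measurable
  set l := hS.eigenvalues rfl
  have hform : (fun x => ⟪x, S x⟫) ∘ (fun x => ∑ i, x i • hS.eigenvectorBasis rfl i)
      = ∑ i, fun x : Fin (Module.finrank ℝ V) → ℝ => l i * x i ^ 2 := by
    ext x
    rw [Finset.sum_apply]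
    exact inner_sum_eigenvectorBasis hS rfl x
  rw [stdGaussian_eq_map_pi_orthonormalBasis (hS.eigenvectorBasis rfl),
    variance_map (by fun_prop) (Measurable.aemeasurable (by fun_prop)), hform, variance_sum_pi
      (X := fun i (x : ℝ) => l i * x ^ 2) fun i => memLp_sq_gaussianReal.const_mul (l i)]
  calc ∑ i, Var[fun x : ℝ => l i * x ^ 2; gaussianReal 0 1]
      ≤ ∑ _ : Fin (Module.finrank ℝ V), c ^ 2 * Var[fun x : ℝ => x ^ 2; gaussianReal 0 1] := by
        gcongr with i
        rw [variance_const_mul]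
        refine mul_le_mul_of_nonneg_right (sq_le_sq.2 ?_) (variance_nonneg _ _)
        exact (abs_eigenvalues_le hS rfl hc i).trans (le_abs_self c)
    _ = _ := by simp

theorem memLp_add_half_norm_sq_sub_stdGaussian (T : V →ₗ[ℝ] V) (a : ℝ) :
    MemLp (fun x => a + (‖T x‖ ^ 2 - ‖x‖ ^ 2) / 2) 2 (stdGaussian V) := by
  obtain ⟨S, hS, hquad⟩ := exists_isSymmetric_inner_eq_half_norm_sq_sub T
  simp only [← hquad]
  exact (memLp_const a).add (memLp_inner_stdGaussian hS)

theorem variance_add_half_norm_sq_sub_stdGaussian_le {T : V →ₗ[ℝ] V} (hT : ∀ x, ‖T x‖ ≤ ‖x‖)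
    (a : ℝ) :
    Var[fun x => a + (‖T x‖ ^ 2 - ‖x‖ ^ 2) / 2; stdGaussian V]
      ≤ Module.finrank ℝ V * ((1 / 2) ^ 2 * Var[fun x : ℝ => x ^ 2; gaussianReal 0 1]) := by
  obtain ⟨S, hS, hquad⟩ := exists_isSymmetric_inner_eq_half_norm_sq_sub T
  have hbound : ∀ x, |⟪x, S x⟫| ≤ 1 / 2 * ‖x‖ ^ 2 := fun x => by
    have hsq : ‖T x‖ ^ 2 ≤ ‖x‖ ^ 2 := pow_le_pow_left₀ (norm_nonneg _) (hT x) 2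
    rw [hquad, abs_le]
    constructor <;> linarith [sq_nonneg ‖T x‖]
  simp only [← hquad]
  exact (variance_const_add (memLp_inner_stdGaussian hS).aestronglyMeasurable a).trans_le
    (variance_inner_stdGaussian_le hS hbound)

end StdGaussian

section SequenceLaws

open scoped RealInnerProductSpace

variable {E : Type*} [NormedAddCommGroup E] [InnerProductSpace ℝ E] [MeasurableSpace E]

/-- The characteristic function, at the coefficients `t`, of the first `N` terms of a random
sequence with law `μ`. -/
def seqCharFun (μ : Measure (ℕ → E)) (N : ℕ) (t : ℕ → E) : ℂ :=
  ∫ y, Complex.exp ((∑ j ∈ Finset.range N, ⟪t j, y j⟫ : ℝ) * Complex.I) ∂μ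

theorem seqCharFun_map [BorelSpace E] [SecondCountableTopology E] {Ω : Type*} [MeasurableSpace Ω]
    {μ : Measure Ω} {X : Ω → ℕ → E} (hX : Measurable X) (N : ℕ) (t : ℕ → E) :
    seqCharFun (μ.map X) N t
      = ∫ ω, Complex.exp ((∑ j ∈ Finset.range N, ⟪t j, X ω j⟫ : ℝ) * Complex.I) ∂μ :=
  integral_map hX.aemeasurable (Measurable.aestronglyMeasurable (by fun_prop))

theorem seqCharFun_infinitePi (μ : Measure E) [IsProbabilityMeasure μ] [BorelSpace E]
    [SecondCountableTopology E] (N : ℕ) (t : ℕ → E) :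
    seqCharFun (Measure.infinitePi fun _ => μ) N t = ∏ j ∈ Finset.range N, charFun μ (t j) := by
  have hprod : ∀ y : ℕ → E, Complex.exp ((∑ j ∈ Finset.range N, ⟪t j, y j⟫ : ℝ) * Complex.I)
      = ∏ j : Finset.range N,
        Complex.exp ((⟪(Finset.range N).restrict y j, t j⟫ : ℝ) * Complex.I) := fun y => by
    rw [← Complex.exp_sum, ← Finset.sum_mul, ← Complex.ofReal_sum, ← Finset.sum_coe_sort]
    simp only [Finset.restrict, real_inner_comm]
  simp_rw [seqCharFun, hprod]
  rw [integral_restrict_infinitePi (μ := fun _ : ℕ => μ) (f := fun x : Finset.range N → E =>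
      ∏ j : Finset.range N, Complex.exp ((⟪x j, t j⟫ : ℝ) * Complex.I))
      (Measurable.aestronglyMeasurable (by fun_prop)),
    integral_fintype_prod_eq_prod (f := fun (j : Finset.range N) (x : E) =>
      Complex.exp ((⟪x, t j⟫ : ℝ) * Complex.I)), Finset.prod_coe_sort (Finset.range N)
      fun j => ∫ x, Complex.exp ((⟪x, t j⟫ : ℝ) * Complex.I) ∂μ]
  simp only [charFun_apply]

theorem seqCharFun_infinitePi_multivariateGaussian {ι : Type*} [Fintype ι] [DecidableEq ι]
    {S : Matrix ι ι ℝ} (hS : S.PosSemidef) (N : ℕ) (t : ℕ → EuclideanSpace ℝ ι) :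
    seqCharFun (Measure.infinitePi fun _ => multivariateGaussian 0 S) N t
      = Complex.exp (-(∑ j ∈ Finset.range N, t j ⬝ᵥ S.mulVec (t j) : ℝ) / 2) := by
  simp only [seqCharFun_infinitePi, charFun_multivariateGaussian hS, inner_zero_right,
    Complex.ofReal_zero, zero_mul, zero_sub, ← Complex.exp_sum, Complex.ofReal_sum,
    Finset.sum_neg_distrib, Finset.sum_div, neg_div]

variable [FiniteDimensional ℝ E] [BorelSpace E]

theorem ext_of_seqCharFun {μ ν : Measure (ℕ → E)} [IsFiniteMeasure μ] [IsFiniteMeasure ν]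
    (h : ∀ N t, seqCharFun μ N t = seqCharFun ν N t) : μ = ν := by
  refine IsProjectiveLimit.unique (P := fun I => ν.map I.restrict) (fun I => ?_) (fun I => rfl)
  have hrestrict : Measurable (I.restrict : (ℕ → E) → I → E) := by fun_prop
  let e := MeasurableEquiv.toLp 2 (I → E)
  suffices hLp : (μ.map I.restrict).map e = (ν.map I.restrict).map e by
    have hcancel := congrArg (Measure.map e.symm) hLp
    rwa [e.map_symm_map, e.map_symm_map] at hcancel
  refine Measure.ext_of_charFun (funext fun t => ?_)
  obtain ⟨N, hN⟩ := I.exists_nat_subset_range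
  have hsum : ∀ y : ℕ → E, ⟪e (I.restrict y), t⟫
      = ∑ j ∈ Finset.range N, ⟪if hj : j ∈ I then t ⟨j, hj⟩ else 0, y j⟫ := fun y => by
    rw [PiLp.inner_apply, ← Finset.sum_subset hN fun j _ hj => by simp [hj],
      ← Finset.sum_coe_sort I fun j => ⟪if hj : j ∈ I then t ⟨j, hj⟩ else 0, y j⟫]
    refine Finset.sum_congr rfl fun j _ => ?_
    rw [dif_pos j.2]
    exact real_inner_comm _ _
  rw [charFun_apply, charFun_apply, Measure.map_map e.measurable hrestrict,
    Measure.map_map e.measurable hrestrict, integral_map (by fun_prop) (by fun_prop),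
    integral_map (by fun_prop) (by fun_prop)]
  simp only [Function.comp_apply, hsum]
  exact h N _

end SequenceLaws

section Costate

open scoped RealInnerProductSpace

variable {E : Type*} [NormedAddCommGroup E] [InnerProductSpace ℝ E] [FiniteDimensional ℝ E]

/-- The solution of the adjoint recursion `l_i = t_i + A* l_{i+1}` with terminal value `l_N = 0`. -/
def costate (A : E →L[ℝ] E) (t : ℕ → E) (N i : ℕ) : E :=
  ∑ j ∈ Finset.Ico i N, (ContinuousLinearMap.adjoint A ^ (j - i)) (t j)

theorem costate_self (A : E →L[ℝ] E) (t : ℕ → E) (N : ℕ) : costate A t N N = 0 := by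
  simp [costate]

theorem costate_of_lt (A : E →L[ℝ] E) (t : ℕ → E) {N i : ℕ} (hi : i < N) :
    costate A t N i = t i + ContinuousLinearMap.adjoint A (costate A t N (i + 1)) := by
  rw [costate, Finset.sum_eq_sum_Ico_succ_bot hi, Nat.sub_self, pow_zero, costate, map_sum]
  congr 1
  refine Finset.sum_congr rfl fun j hj => ?_
  rw [show j - i = j - (i + 1) + 1 by have := (Finset.mem_Ico.1 hj).1; omega, pow_succ']
  rfl

theorem sum_inner_eq_sum_inner_costate {A : E →L[ℝ] E} {x d : ℕ → E}
    (hx : ∀ i, x (i + 1) = A (x i) + d i) (t : ℕ → E) (N : ℕ) :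
    ∑ j ∈ Finset.range N, ⟪t j, x j⟫
      = ⟪costate A t N 0, x 0⟫ + ∑ j ∈ Finset.range N, ⟪costate A t N (j + 1), d j⟫ := by
  have htelescope : ∀ j ∈ Finset.range N, ⟪t j, x j⟫ - ⟪costate A t N (j + 1), d j⟫
      = ⟪costate A t N j, x j⟫ - ⟪costate A t N (j + 1), x (j + 1)⟫ := fun j hj => by
    rw [hx j, costate_of_lt A t (Finset.mem_range.1 hj), inner_add_left, inner_add_right,
      ContinuousLinearMap.adjoint_inner_left]
    ring
  have hsum := Finset.sum_congr rfl htelescope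
  rw [Finset.sum_range_sub', costate_self, inner_zero_left, sub_zero,
    Finset.sum_sub_distrib] at hsum
  linarith

end Costate

section DrivenRecursion

variable {E G : Type*} [NormedAddCommGroup E] [NormedSpace ℝ E] [NormedAddCommGroup G]
  [NormedSpace ℝ G]

/-- The operator which maps an input sequence `e` to the solution of `x_{i+1} = F_i x_i + K_i e_i`,
`x_0 = 0`. -/
def linearRecursion (F : ℕ → E →L[ℝ] E) (K : ℕ → G →L[ℝ] E) : (ℕ → G) →L[ℝ] (ℕ → E) :=
  ContinuousLinearMap.pi <| Nat.rec 0 fun i x => F i ∘L x + K i ∘L ContinuousLinearMap.proj i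

variable (F : ℕ → E →L[ℝ] E) (K : ℕ → G →L[ℝ] E)

theorem linearRecursion_apply_zero (e : ℕ → G) : linearRecursion F K e 0 = 0 := rfl

theorem linearRecursion_apply_succ (e : ℕ → G) (i : ℕ) :
    linearRecursion F K e (i + 1) = F i (linearRecursion F K e i) + K i (e i) := rfl

theorem one_sub_linearRecursion_mul_one_add_linearRecursion (A K : ℕ → E →L[ℝ] E) :
    (1 - linearRecursion (fun i => A i - K i) K) * (1 + linearRecursion A K) = 1 := by
  suffices h : ∀ (e : ℕ → E) (i : ℕ),
      linearRecursion (fun i => A i - K i) K (e + linearRecursion A K e) i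
        = linearRecursion A K e i by
    ext e i : 2
    change e i + linearRecursion A K e i
      - linearRecursion (fun i => A i - K i) K (e + linearRecursion A K e) i = e i
    rw [h, add_sub_cancel_right]
  intro e i
  induction i with
  | zero => rfl
  | succ i ih =>
    simp only [linearRecursion_apply_succ, ih, Pi.add_apply, _root_.sub_apply, map_add]
    abel

end DrivenRecursion

section StdNoise

variable (E : Type*) [NormedAddCommGroup E] [InnerProductSpace ℝ E] [FiniteDimensional ℝ E]
  [MeasurableSpace E] [BorelSpace E]

/-- The law of a sequence of independent standard Gaussian vectors. -/
def stdNoise : Measure (ℕ → E) :=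
  Measure.infinitePi fun _ => stdGaussian E

instance : IsProbabilityMeasure (stdNoise E) := by
  unfold stdNoise
  infer_instance

theorem seqCharFun_stdNoise (N : ℕ) (t : ℕ → E) :
    seqCharFun (stdNoise E) N t = Complex.exp (-(∑ j ∈ Finset.range N, ‖t j‖ ^ 2 : ℝ) / 2) := by
  simp only [stdNoise, seqCharFun_infinitePi, charFun_stdGaussian, ← Complex.exp_sum,
    ← Finset.sum_div, Finset.sum_neg_distrib, Complex.ofReal_sum, Complex.ofReal_pow]

end StdNoise

/-! ### The innovations representation of the observations -/

section Innovations

open scoped RealInnerProductSpace Matrix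

local notation "toCLM" => Matrix.toEuclideanCLM (𝕜 := ℝ)

theorem adjoint_toEuclideanCLM {ι : Type*} [Fintype ι] [DecidableEq ι] (N : Matrix ι ι ℝ) :
    ContinuousLinearMap.adjoint (toCLM N) = toCLM Nᵀ := by
  rw [← ContinuousLinearMap.star_eq_adjoint, ← map_star, Matrix.star_eq_conjTranspose,
    Matrix.conjTranspose_eq_transpose_of_trivial]

theorem inner_toEuclideanLin_right {ι κ : Type*} [Fintype ι] [DecidableEq ι] [Fintype κ]
    [DecidableEq κ] (N : Matrix ι κ ℝ) (x : EuclideanSpace ℝ ι) (y : EuclideanSpace ℝ κ) :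
    ⟪x, Matrix.toEuclideanLin N y⟫ = ⟪Matrix.toEuclideanLin Nᵀ x, y⟫ := by
  rw [← Matrix.conjTranspose_eq_transpose_of_trivial,
    Matrix.toEuclideanLin_conjTranspose_eq_adjoint, LinearMap.adjoint_inner_left]

theorem dotProduct_mulVec_transpose_mulVec_add {ι : Type*} [Fintype ι] {S : Matrix ι ι ℝ}
    (hS : S.IsSymm) (N : Matrix ι ι ℝ) (x t : ι → ℝ) :
    (Nᵀ *ᵥ x + t) ⬝ᵥ S *ᵥ (Nᵀ *ᵥ x + t)
      = x ⬝ᵥ (N * S * Nᵀ) *ᵥ x + 2 * (x ⬝ᵥ (N * S) *ᵥ t) + t ⬝ᵥ S *ᵥ t := by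
  have hswap : t ⬝ᵥ S *ᵥ (Nᵀ *ᵥ x) = x ⬝ᵥ (N * S) *ᵥ t := by
    rw [Matrix.mulVec_mulVec, Matrix.dotProduct_mulVec, ← Matrix.mulVec_transpose,
      Matrix.transpose_mul, Matrix.transpose_transpose, hS.eq, dotProduct_comm]
  have hmove : ∀ y : ι → ℝ, (Nᵀ *ᵥ x) ⬝ᵥ S *ᵥ y = x ⬝ᵥ (N * S) *ᵥ y := fun y => by
    rw [Matrix.mulVec_transpose, ← Matrix.dotProduct_mulVec, Matrix.mulVec_mulVec]
  rw [add_dotProduct, Matrix.mulVec_add, dotProduct_add, dotProduct_add, hmove, hmove, hswap,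
    Matrix.mulVec_mulVec]
  ring

namespace VectorModel

variable {m p : ℕ} (M : VectorModel m p)

/-- The Kalman gain at time `i`. -/
def gain (i : ℕ) : Matrix (Fin m) (Fin m) ℝ := M.Kp (M.riccatiSeq i)

open scoped MatrixOrder in
/-- The symmetric square root of the innovation covariance at time `i`. -/
def root (i : ℕ) : Matrix (Fin m) (Fin m) ℝ := CFC.sqrt (M.Re (M.riccatiSeq i))

/-- The Kalman filter: the one-step predictions of an observation path under `H₁`. -/
def predictor : (ℕ → EuclideanSpace ℝ (Fin m)) →L[ℝ] (ℕ → EuclideanSpace ℝ (Fin m)) :=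
  linearRecursion (fun i => toCLM M.A - toCLM (M.gain i)) fun i => toCLM (M.gain i)

/-- The innovations under `H₁` as a function of a standard white noise. -/
def coloring : (ℕ → EuclideanSpace ℝ (Fin m)) →L[ℝ] (ℕ → EuclideanSpace ℝ (Fin m)) :=
  ContinuousLinearMap.piMap fun i => toCLM (M.root i)

/-- The observation path as a function of the innovations: the causal inverse of
`1 - M.predictor`. -/
def resynthesis : (ℕ → EuclideanSpace ℝ (Fin m)) →L[ℝ] (ℕ → EuclideanSpace ℝ (Fin m)) :=
  1 + linearRecursion (fun _ => toCLM M.A) fun i => toCLM (M.gain i)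

/-- The observation path under `H₁` as a causal function of a standard white noise. -/
def synthesis : (ℕ → EuclideanSpace ℝ (Fin m)) →L[ℝ] (ℕ → EuclideanSpace ℝ (Fin m)) :=
  M.resynthesis * M.coloring

theorem one_sub_predictor_mul_resynthesis : (1 - M.predictor) * M.resynthesis = 1 :=
  one_sub_linearRecursion_mul_one_add_linearRecursion _ _

theorem one_sub_predictor_mul_synthesis : (1 - M.predictor) * M.synthesis = M.coloring := by
  rw [synthesis, ← mul_assoc, one_sub_predictor_mul_resynthesis, one_mul]

/-- The costate of the signal dynamics. -/
def signalCostate (t : ℕ → EuclideanSpace ℝ (Fin m)) (N i : ℕ) : EuclideanSpace ℝ (Fin m) :=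
  costate (toCLM M.A) t N i

theorem signalCostate_self (t : ℕ → EuclideanSpace ℝ (Fin m)) (N : ℕ) :
    M.signalCostate t N N = 0 :=
  costate_self _ _ _

theorem ofLp_signalCostate_of_lt (t : ℕ → EuclideanSpace ℝ (Fin m)) {N j : ℕ} (hj : j < N) :
    (M.signalCostate t N j).ofLp
      = M.Aᵀ *ᵥ (M.signalCostate t N (j + 1)).ofLp + (t j).ofLp := by
  rw [signalCostate, costate_of_lt _ t hj, adjoint_toEuclideanCLM, WithLp.ofLp_add,
    Matrix.ofLp_toEuclideanCLM, add_comm, signalCostate]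

/-- The coefficients of the white noise `w` in the linear functional `∑ j < N, ⟪t j, y j⟫` of the
observations `y = M.synthesis w`. -/
def synthesisAdjoint (N : ℕ) (t : ℕ → EuclideanSpace ℝ (Fin m)) (j : ℕ) :
    EuclideanSpace ℝ (Fin m) :=
  toCLM (M.root j) (toCLM (M.gain j)ᵀ (M.signalCostate t N (j + 1)) + t j)

theorem measurable_signal (i : ℕ) :
    Measurable fun ω : EuclideanSpace ℝ (Fin m) × (ℕ → EuclideanSpace ℝ (Fin p)) =>
      M.signal ω.1 ω.2 i := by
  have hA := (Matrix.toEuclideanLin M.A).continuous_of_finiteDimensional.measurable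
  have hB := (Matrix.toEuclideanLin M.B).continuous_of_finiteDimensional.measurable
  induction i with
  | zero => exact measurable_fst
  | succ i ih =>
    exact (hA.comp ih).add (hB.comp ((measurable_pi_apply i).comp measurable_snd))

theorem measurable_observation :
    Measurable fun (ω : EuclideanSpace ℝ (Fin m) × (ℕ → EuclideanSpace ℝ (Fin p)) ×
      (ℕ → EuclideanSpace ℝ (Fin m))) i => M.signal ω.1 ω.2.1 i + ω.2.2 i :=
  measurable_pi_lambda _ fun i =>
    ((M.measurable_signal i).comp (measurable_fst.prodMk (measurable_fst.comp measurable_snd))).add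
      ((measurable_pi_apply i).comp (measurable_snd.comp measurable_snd))

instance : IsProbabilityMeasure M.noiseLaw := by
  unfold noiseLaw
  infer_instance

instance : IsProbabilityMeasure M.inputLaw := by
  unfold inputLaw
  infer_instance

instance : IsProbabilityMeasure M.lawH0 :=
  inferInstanceAs (IsProbabilityMeasure M.noiseLaw)

instance : IsProbabilityMeasure M.lawH1 :=
  Measure.isProbabilityMeasure_map M.measurable_observation.aemeasurable

theorem seqCharFun_noiseLaw (N : ℕ) (t : ℕ → EuclideanSpace ℝ (Fin m)) :
    seqCharFun M.noiseLaw N t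
      = Complex.exp (-(M.σ ^ 2 * ∑ j ∈ Finset.range N, ‖t j‖ ^ 2 : ℝ) / 2) := by
  have hnorm : ∀ x : EuclideanSpace ℝ (Fin m),
      x ⬝ᵥ (M.σ ^ 2 • (1 : Matrix (Fin m) (Fin m) ℝ)) *ᵥ x = M.σ ^ 2 * ‖x‖ ^ 2 := fun x => by
    rw [Matrix.smul_mulVec, Matrix.one_mulVec, dotProduct_smul, smul_eq_mul,
      EuclideanSpace.real_norm_sq_eq]
    simp only [dotProduct, pow_two]
  rw [noiseLaw, seqCharFun_infinitePi_multivariateGaussian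
    (Matrix.PosSemidef.one.smul (sq_nonneg M.σ)), Finset.mul_sum]
  simp only [hnorm]

theorem lawH0_eq_map_stdNoise :
    M.lawH0 = (stdNoise (EuclideanSpace ℝ (Fin m))).map (M.σ • ·) := by
  have := Measure.isProbabilityMeasure_map (μ := stdNoise (EuclideanSpace ℝ (Fin m)))
    (f := (M.σ • ·)) (by fun_prop)
  refine ext_of_seqCharFun fun N t => ?_
  calc seqCharFun M.lawH0 N t
      = seqCharFun (stdNoise _) N (M.σ • t) := by
        rw [lawH0, seqCharFun_noiseLaw, seqCharFun_stdNoise]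
        simp only [Pi.smul_apply, norm_smul, mul_pow, Finset.mul_sum, Real.norm_eq_abs, sq_abs]
    _ = seqCharFun ((stdNoise _).map (M.σ • ·)) N t := by
        rw [seqCharFun_map (by fun_prop)]
        simp only [seqCharFun, Pi.smul_apply, inner_smul_left, inner_smul_right, conj_trivial]

theorem sum_inner_signal (N : ℕ) (t : ℕ → EuclideanSpace ℝ (Fin m))
    (s : EuclideanSpace ℝ (Fin m)) (u : ℕ → EuclideanSpace ℝ (Fin p)) :
    ∑ j ∈ Finset.range N, ⟪t j, M.signal s u j⟫ = ⟪M.signalCostate t N 0, s⟫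
      + ∑ j ∈ Finset.range N,
        ⟪Matrix.toEuclideanLin M.Bᵀ (M.signalCostate t N (j + 1)), u j⟫ := by
  rw [sum_inner_eq_sum_inner_costate (x := M.signal s u)
    (A := toCLM M.A) (d := fun i => Matrix.toEuclideanLin M.B (u i)) (fun i => rfl), signal]
  simp only [inner_toEuclideanLin_right, signalCostate]

variable {M}

theorem seqCharFun_lawH1 (hQ : M.Q.PosSemidef) (hC₀ : M.C₀.PosSemidef) (N : ℕ)
    (t : ℕ → EuclideanSpace ℝ (Fin m)) :
    seqCharFun M.lawH1 N t
      = Complex.exp (-(M.signalCostate t N 0 ⬝ᵥ M.C₀ *ᵥ M.signalCostate t N 0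
        + ∑ j ∈ Finset.range N, (M.Bᵀ *ᵥ M.signalCostate t N (j + 1))
          ⬝ᵥ M.Q *ᵥ (M.Bᵀ *ᵥ M.signalCostate t N (j + 1))
        + M.σ ^ 2 * ∑ j ∈ Finset.range N, ‖t j‖ ^ 2 : ℝ) / 2) := by
  set l := M.signalCostate t N
  have hsplit : ∀ (s : EuclideanSpace ℝ (Fin m)) (u : ℕ → EuclideanSpace ℝ (Fin p))
      (w : ℕ → EuclideanSpace ℝ (Fin m)),
      Complex.exp ((∑ j ∈ Finset.range N, ⟪t j, M.signal s u j + w j⟫ : ℝ) * Complex.I)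
        = Complex.exp ((⟪s, l 0⟫ : ℝ) * Complex.I)
          * (Complex.exp ((∑ j ∈ Finset.range N,
              ⟪Matrix.toEuclideanLin M.Bᵀ (l (j + 1)), u j⟫ : ℝ) * Complex.I)
            * Complex.exp ((∑ j ∈ Finset.range N, ⟪t j, w j⟫ : ℝ) * Complex.I)) := by
    intro s u w
    simp only [inner_add_right, Finset.sum_add_distrib, M.sum_inner_signal N t s u,
      ← Complex.exp_add, Complex.ofReal_add, add_mul, add_assoc, real_inner_comm s, l]
  have hfactor : seqCharFun M.lawH1 N t = charFun (multivariateGaussian 0 M.C₀) (l 0)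
      * (seqCharFun M.inputLaw N (fun j => Matrix.toEuclideanLin M.Bᵀ (l (j + 1)))
        * seqCharFun M.noiseLaw N t) := by
    rw [lawH1, seqCharFun_map M.measurable_observation]
    simp only [hsplit]
    rw [charFun_apply, seqCharFun, seqCharFun, ← integral_prod_mul, ← integral_prod_mul]
  rw [hfactor, charFun_multivariateGaussian hC₀, inputLaw,
    seqCharFun_infinitePi_multivariateGaussian hQ, seqCharFun_noiseLaw, ← Complex.exp_add,
    ← Complex.exp_add]
  simp only [inner_zero_right, Matrix.ofLp_toLpLin, Matrix.toLin'_apply]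
  congr 1
  push_cast
  ring

open scoped MatrixOrder in
theorem root_mul_root (hσ : 0 < M.σ) (hQ : M.Q.PosSemidef) (hC₀ : M.C₀.PosSemidef)
    (i : ℕ) : M.root i * M.root i = M.Re (M.riccatiSeq i) :=
  CFC.sqrt_mul_sqrt_self _ (posDef_Re hσ (posSemidef_riccatiSeq hσ hQ hC₀ i)).posSemidef.nonneg

open scoped MatrixOrder in
theorem transpose_root (i : ℕ) : (M.root i)ᵀ = M.root i :=
  (CFC.sqrt_nonneg (M.Re (M.riccatiSeq i))).isSelfAdjoint

theorem norm_sq_root_apply (hσ : 0 < M.σ) (hQ : M.Q.PosSemidef) (hC₀ : M.C₀.PosSemidef)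
    (i : ℕ) (x : EuclideanSpace ℝ (Fin m)) :
    ‖toCLM (M.root i) x‖ ^ 2 = x ⬝ᵥ M.Re (M.riccatiSeq i) *ᵥ x := by
  rw [← real_inner_self_eq_norm_sq, ← ContinuousLinearMap.adjoint_inner_right,
    adjoint_toEuclideanCLM, transpose_root, ← mul_apply_eq_comp, ← map_mul,
    root_mul_root hσ hQ hC₀, Matrix.inner_toEuclideanCLM]

theorem Kp_mul_Re {P : Matrix (Fin m) (Fin m) ℝ} (h : IsUnit (M.Re P).det) :
    M.Kp P * M.Re P = M.A * P := by
  rw [Kp, mul_assoc, Matrix.nonsing_inv_mul _ h, mul_one]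

theorem riccatiStep_eq_sub_Kp_mul_Re_mul {P : Matrix (Fin m) (Fin m) ℝ}
    (h : IsUnit (M.Re P).det) (hP : P.IsSymm) :
    M.riccatiStep P = M.A * P * M.Aᵀ + M.B * M.Q * M.Bᵀ
      - M.Kp P * M.Re P * (M.Kp P)ᵀ := by
  rw [riccatiStep, Kp_mul_Re h, Kp, Matrix.transpose_mul, Matrix.transpose_mul,
    transpose_inv_Re hP, hP.eq]
  simp only [mul_assoc]

/-- Completing the square in the Riccati recursion. -/
theorem dotProduct_Re_mulVec {P : Matrix (Fin m) (Fin m) ℝ} (h : IsUnit (M.Re P).det)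
    (hP : P.IsSymm) (l t : Fin m → ℝ) :
    ((M.Kp P)ᵀ *ᵥ l + t) ⬝ᵥ M.Re P *ᵥ ((M.Kp P)ᵀ *ᵥ l + t)
      = (M.Aᵀ *ᵥ l + t) ⬝ᵥ P *ᵥ (M.Aᵀ *ᵥ l + t) + (M.Bᵀ *ᵥ l) ⬝ᵥ M.Q *ᵥ (M.Bᵀ *ᵥ l)
        - l ⬝ᵥ M.riccatiStep P *ᵥ l + M.σ ^ 2 * (t ⬝ᵥ t) := by
  have hRe : (M.Re P).IsSymm := by simp [Matrix.IsSymm, Re, hP.eq]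
  have hinput : (M.Bᵀ *ᵥ l) ⬝ᵥ M.Q *ᵥ (M.Bᵀ *ᵥ l) = l ⬝ᵥ (M.B * M.Q * M.Bᵀ) *ᵥ l := by
    rw [Matrix.mulVec_transpose, ← Matrix.dotProduct_mulVec, ← Matrix.mulVec_transpose,
      Matrix.mulVec_mulVec, Matrix.mulVec_mulVec]
  have ht : t ⬝ᵥ M.Re P *ᵥ t = M.σ ^ 2 * (t ⬝ᵥ t) + t ⬝ᵥ P *ᵥ t := by
    rw [Re, Matrix.add_mulVec, dotProduct_add, Matrix.smul_mulVec, Matrix.one_mulVec,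
      dotProduct_smul, smul_eq_mul]
  rw [dotProduct_mulVec_transpose_mulVec_add hRe, dotProduct_mulVec_transpose_mulVec_add hP,
    riccatiStep_eq_sub_Kp_mul_Re_mul h hP, Matrix.sub_mulVec, Matrix.add_mulVec, dotProduct_sub,
    dotProduct_add, hinput, ht, Kp_mul_Re h]
  ring

theorem norm_sq_synthesisAdjoint (hσ : 0 < M.σ) (hQ : M.Q.PosSemidef) (hC₀ : M.C₀.PosSemidef)
    {N j : ℕ} (hj : j < N) (t : ℕ → EuclideanSpace ℝ (Fin m)) :
    ‖M.synthesisAdjoint N t j‖ ^ 2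
      = (M.signalCostate t N j ⬝ᵥ M.riccatiSeq j *ᵥ M.signalCostate t N j
          - M.signalCostate t N (j + 1)
            ⬝ᵥ M.riccatiSeq (j + 1) *ᵥ M.signalCostate t N (j + 1))
        + (M.Bᵀ *ᵥ M.signalCostate t N (j + 1))
          ⬝ᵥ M.Q *ᵥ (M.Bᵀ *ᵥ M.signalCostate t N (j + 1))
        + M.σ ^ 2 * ‖t j‖ ^ 2 := by
  have hP := posSemidef_riccatiSeq hσ hQ hC₀ j
  have hnorm : ‖t j‖ ^ 2 = (t j).ofLp ⬝ᵥ (t j).ofLp := by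
    simp only [EuclideanSpace.real_norm_sq_eq, dotProduct, ← pow_two]
  rw [synthesisAdjoint, norm_sq_root_apply hσ hQ hC₀, WithLp.ofLp_add,
    Matrix.ofLp_toEuclideanCLM, gain, dotProduct_Re_mulVec (isUnit_det_Re hσ hP) hP.isHermitian,
    ofLp_signalCostate_of_lt M t hj, hnorm, riccatiSeq]
  ring

theorem sum_norm_sq_synthesisAdjoint (hσ : 0 < M.σ) (hQ : M.Q.PosSemidef)
    (hC₀ : M.C₀.PosSemidef) (N : ℕ) (t : ℕ → EuclideanSpace ℝ (Fin m)) :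
    ∑ j ∈ Finset.range N, ‖M.synthesisAdjoint N t j‖ ^ 2
      = M.signalCostate t N 0 ⬝ᵥ M.C₀ *ᵥ M.signalCostate t N 0
        + ∑ j ∈ Finset.range N, (M.Bᵀ *ᵥ M.signalCostate t N (j + 1))
          ⬝ᵥ M.Q *ᵥ (M.Bᵀ *ᵥ M.signalCostate t N (j + 1))
        + M.σ ^ 2 * ∑ j ∈ Finset.range N, ‖t j‖ ^ 2 := by
  rw [Finset.sum_congr rfl fun j hj =>
      norm_sq_synthesisAdjoint hσ hQ hC₀ (Finset.mem_range.1 hj) t,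
    Finset.sum_add_distrib, Finset.sum_add_distrib, Finset.sum_range_sub', signalCostate_self,
    ← Finset.mul_sum, riccatiSeq, WithLp.ofLp_zero, zero_dotProduct, sub_zero]

theorem sum_inner_synthesis (N : ℕ) (t w : ℕ → EuclideanSpace ℝ (Fin m)) :
    ∑ j ∈ Finset.range N, ⟪t j, M.synthesis w j⟫
      = ∑ j ∈ Finset.range N, ⟪M.synthesisAdjoint N t j, w j⟫ := by
  have hroot : ∀ (j : ℕ) (x : EuclideanSpace ℝ (Fin m)),
      ⟪toCLM (M.root j) x, w j⟫ = ⟪x, M.coloring w j⟫ := fun j x => by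
    rw [← ContinuousLinearMap.adjoint_inner_right, adjoint_toEuclideanCLM, transpose_root]
    rfl
  have hstate := sum_inner_eq_sum_inner_costate (linearRecursion_apply_succ
    (fun _ => toCLM M.A) (fun i => toCLM (M.gain i)) (M.coloring w)) t N
  rw [linearRecursion_apply_zero, inner_zero_right, zero_add] at hstate
  change ∑ j ∈ Finset.range N, ⟪t j, M.coloring w j + linearRecursion _ _ (M.coloring w) j⟫ = _
  simp only [synthesisAdjoint, hroot, inner_add_right, inner_add_left, Finset.sum_add_distrib,
    hstate, ← adjoint_toEuclideanCLM, ContinuousLinearMap.adjoint_inner_left]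
  exact add_comm _ _

/-- Both laws are Gaussian, and summing the completed squares shows that the white noise
coefficients of a linear functional carry exactly its variance under `H₁`. -/
theorem lawH1_eq_map_stdNoise (hσ : 0 < M.σ) (hQ : M.Q.PosSemidef) (hC₀ : M.C₀.PosSemidef) :
    M.lawH1 = (stdNoise (EuclideanSpace ℝ (Fin m))).map M.synthesis := by
  have hmeas : Measurable M.synthesis := M.synthesis.continuous.measurable
  have := Measure.isProbabilityMeasure_map (μ := stdNoise (EuclideanSpace ℝ (Fin m)))
    hmeas.aemeasurable
  refine ext_of_seqCharFun fun N t => ?_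
  calc seqCharFun M.lawH1 N t = seqCharFun (stdNoise _) N (M.synthesisAdjoint N t) := by
        rw [seqCharFun_lawH1 hQ hC₀, seqCharFun_stdNoise,
          sum_norm_sq_synthesisAdjoint hσ hQ hC₀]
    _ = seqCharFun ((stdNoise _).map M.synthesis) N t := by
        rw [seqCharFun_map hmeas]
        simp only [sum_inner_synthesis, seqCharFun]

end VectorModel

end Innovations

/-! ### Finite sections of causal operators -/

section FiniteSection

variable {E : Type*} [NormedAddCommGroup E] [NormedSpace ℝ E]

/-- The output of `T` at time `i` does not depend on the input after time `i - d`: for `d = 0` the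
operator is causal, for `d = 1` strictly causal. -/
def HasDelay (T : (ℕ → E) →L[ℝ] (ℕ → E)) (d : ℕ) : Prop :=
  ∀ (x : ℕ → E) (i : ℕ), (∀ j, j + d ≤ i → x j = 0) → T x i = 0

namespace HasDelay

variable {S T : (ℕ → E) →L[ℝ] (ℕ → E)} {c d : ℕ}

theorem mono (hT : HasDelay T d) (hcd : c ≤ d) : HasDelay T c := fun x i hx =>
  hT x i fun j hj => hx j (by omega)

theorem one : HasDelay (1 : (ℕ → E) →L[ℝ] (ℕ → E)) 0 := fun _ i hx => hx i le_rfl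

theorem add (hS : HasDelay S d) (hT : HasDelay T d) : HasDelay (S + T) d := fun x i hx => by
  rw [add_apply, Pi.add_apply, hS x i hx, hT x i hx, add_zero]

theorem sub (hS : HasDelay S d) (hT : HasDelay T d) : HasDelay (S - T) d := fun x i hx => by
  rw [sub_apply, Pi.sub_apply, hS x i hx, hT x i hx, sub_zero]

theorem mul (hS : HasDelay S c) (hT : HasDelay T d) : HasDelay (S * T) (c + d) := fun x i hx =>
  hS _ i fun j hj => hT x j fun k hk => hx k (by omega)

theorem pow (hT : HasDelay T d) : ∀ k : ℕ, HasDelay (T ^ k) (k * d)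
  | 0 => by simpa using one
  | k + 1 => by simpa only [pow_succ, Nat.succ_mul] using (hT.pow k).mul hT

theorem piMap (D : ℕ → E →L[ℝ] E) : HasDelay (ContinuousLinearMap.piMap D) 0 := fun x i hx => by
  rw [ContinuousLinearMap.coe_piMap', Pi.map_apply, hx i le_rfl, map_zero]

theorem linearRecursion (F K : ℕ → E →L[ℝ] E) : HasDelay (linearRecursion F K) 1 := by
  intro x i hx
  induction i with
  | zero => rfl
  | succ i ih =>
    rw [linearRecursion_apply_succ, ih fun j hj => hx j (by omega), hx i le_rfl, map_zero,
      map_zero, add_zero]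

end HasDelay

/-- The first `N` terms of a sequence. -/
def firstTerms (N : ℕ) : (ℕ → E) →L[ℝ] PiLp 2 fun _ : Fin N => E :=
  (PiLp.continuousLinearEquiv 2 ℝ fun _ : Fin N => E).symm.toContinuousLinearMap ∘L
    ContinuousLinearMap.pi fun i => ContinuousLinearMap.proj (i : ℕ)

/-- The extension of a finite sequence by zero. -/
def zeroExtend (N : ℕ) : (PiLp 2 fun _ : Fin N => E) →ₗ[ℝ] (ℕ → E) :=
  LinearMap.pi fun j => if hj : j < N then PiLp.projₗ 2 (fun _ : Fin N => E) ⟨j, hj⟩ else 0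

/-- The compression of an operator on sequences to the first `N` terms. -/
def finiteSection (T : (ℕ → E) →L[ℝ] (ℕ → E)) (N : ℕ) :
    (PiLp 2 fun _ : Fin N => E) →ₗ[ℝ] PiLp 2 fun _ : Fin N => E :=
  (firstTerms N).toLinearMap ∘ₗ T.toLinearMap ∘ₗ zeroExtend N

variable {N : ℕ}

theorem zeroExtend_of_lt (v : PiLp 2 fun _ : Fin N => E) {j : ℕ} (hj : j < N) :
    zeroExtend N v j = v ⟨j, hj⟩ := by
  simp only [zeroExtend, LinearMap.pi_apply, dif_pos hj, PiLp.projₗ_apply]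

theorem continuous_zeroExtend (N : ℕ) :
    Continuous (zeroExtend N : (PiLp 2 fun _ : Fin N => E) →ₗ[ℝ] (ℕ → E)) := by
  refine continuous_pi fun j => ?_
  rcases lt_or_ge j N with hj | hj
  · simp only [zeroExtend_of_lt _ hj]
    fun_prop
  · simp only [zeroExtend, LinearMap.pi_apply, dif_neg hj.not_gt, LinearMap.zero_apply]
    fun_prop

theorem firstTerms_zeroExtend (v : PiLp 2 fun _ : Fin N => E) : firstTerms N (zeroExtend N v) = v :=
  PiLp.ext fun i => zeroExtend_of_lt v i.2

variable {S T : (ℕ → E) →L[ℝ] (ℕ → E)}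

theorem HasDelay.apply_zeroExtend_firstTerms {d i : ℕ} (hT : HasDelay T d) (hi : i < N + d)
    (x : ℕ → E) : T (zeroExtend N (firstTerms N x)) i = T x i := by
  rw [← sub_eq_zero, ← Pi.sub_apply, ← map_sub]
  refine hT _ i fun j hj => sub_eq_zero.2 ?_
  exact zeroExtend_of_lt _ (by omega)

theorem finiteSection_firstTerms (hT : HasDelay T 0) (x : ℕ → E) :
    finiteSection T N (firstTerms N x) = firstTerms N (T x) :=
  PiLp.ext fun i => hT.apply_zeroExtend_firstTerms i.2 x

theorem continuous_finiteSection (T : (ℕ → E) →L[ℝ] (ℕ → E)) (N : ℕ) :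
    Continuous (finiteSection T N) :=
  (firstTerms N).continuous.comp (T.continuous.comp (continuous_zeroExtend N))

theorem finiteSection_one : finiteSection (1 : (ℕ → E) →L[ℝ] (ℕ → E)) N = 1 :=
  LinearMap.ext firstTerms_zeroExtend

theorem finiteSection_add (S T : (ℕ → E) →L[ℝ] (ℕ → E)) :
    finiteSection (S + T) N = finiteSection S N + finiteSection T N := rfl

theorem finiteSection_mul (hS : HasDelay S 0) (T : (ℕ → E) →L[ℝ] (ℕ → E)) :
    finiteSection (S * T) N = finiteSection S N * finiteSection T N :=
  LinearMap.ext fun v => (finiteSection_firstTerms hS (T (zeroExtend N v))).symm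

theorem finiteSection_pow (hT : HasDelay T 0) : ∀ k : ℕ,
    finiteSection (T ^ k) N = finiteSection T N ^ k
  | 0 => finiteSection_one
  | k + 1 => by rw [pow_succ', finiteSection_mul hT, finiteSection_pow hT k, pow_succ']

theorem finiteSection_eq_zero (hT : HasDelay T N) : finiteSection T N = 0 :=
  LinearMap.ext fun v => PiLp.ext fun i => hT (zeroExtend N v) i fun j hj => by omega

theorem isNilpotent_finiteSection (hT : HasDelay T 1) : IsNilpotent (finiteSection T N) :=
  ⟨N, by
    rw [← finiteSection_pow (hT.mono zero_le_one), finiteSection_eq_zero]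
    simpa only [mul_one] using hT.pow N⟩

variable [FiniteDimensional ℝ E]

theorem HasDelay.exists_apply_eq_firstTerms (hT : HasDelay T 0) (i : ℕ) :
    ∃ L : (PiLp 2 fun _ : Fin (i + 1) => E) →L[ℝ] E, ∀ w, T w i = L (firstTerms (i + 1) w) :=
  ⟨(LinearMap.proj i ∘ₗ T.toLinearMap ∘ₗ zeroExtend (i + 1)).toContinuousLinearMap, fun w =>
    (hT.apply_zeroExtend_firstTerms i.lt_succ_self w).symm⟩

theorem det_finiteSection_one_add (hT : HasDelay T 1) :
    LinearMap.det (finiteSection (1 + T) N) = 1 := by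
  have hcharpoly := LinearMap.eval_charpoly (-finiteSection T N) 1
  rw [(isNilpotent_finiteSection hT).neg.charpoly_eq_X_pow_finrank, Polynomial.eval_pow,
    Polynomial.eval_X, one_pow, map_one, sub_neg_eq_add, ← finiteSection_one,
    ← finiteSection_add] at hcharpoly
  exact hcharpoly.symm

theorem det_finiteSection_piMap (D : ℕ → E →L[ℝ] E) :
    LinearMap.det (finiteSection (ContinuousLinearMap.piMap D) N)
      = ∏ i ∈ Finset.range N, LinearMap.det (D i : E →ₗ[ℝ] E) := by
  have hconj : finiteSection (ContinuousLinearMap.piMap D) N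
      = (WithLp.linearEquiv 2 ℝ (Fin N → E)).symm ∘ₗ
        (LinearMap.pi fun i : Fin N => (D i : E →ₗ[ℝ] E) ∘ₗ LinearMap.proj i) ∘ₗ
        (WithLp.linearEquiv 2 ℝ (Fin N → E)).symm.symm :=
    LinearMap.ext fun v => PiLp.ext fun i => congrArg (D i) (zeroExtend_of_lt v i.2)
  rw [hconj, LinearMap.det_conj, LinearMap.det_pi,
    Fin.prod_univ_eq_prod_range fun i => LinearMap.det (D i : E →ₗ[ℝ] E)]

end FiniteSection

section FiniteSectionInner

open scoped RealInnerProductSpace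

variable {E : Type*} [NormedAddCommGroup E] [InnerProductSpace ℝ E]

theorem inner_firstTerms (N : ℕ) (x y : ℕ → E) :
    ⟪firstTerms N x, firstTerms N y⟫ = ∑ i ∈ Finset.range N, ⟪x i, y i⟫ := by
  rw [PiLp.inner_apply, ← Fin.sum_univ_eq_sum_range fun i => ⟪x i, y i⟫]
  rfl

theorem norm_sq_firstTerms (N : ℕ) (x : ℕ → E) :
    ‖firstTerms N x‖ ^ 2 = ∑ i ∈ Finset.range N, ‖x i‖ ^ 2 := by
  simp only [← real_inner_self_eq_norm_sq, inner_firstTerms]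

theorem norm_le_of_mul_eq_one_of_norm_le_adjoint {V : Type*} [NormedAddCommGroup V]
    [InnerProductSpace ℝ V] [FiniteDimensional ℝ V] {W T : V →ₗ[ℝ] V} (h : W * T = 1)
    (hT : ∀ t, ‖t‖ ≤ ‖LinearMap.adjoint T t‖) (v : V) : ‖W v‖ ≤ ‖v‖ := by
  set t := LinearMap.adjoint W (W v) with ht_def
  have ht : LinearMap.adjoint T t = W v := by
    refine ext_inner_right ℝ fun x => ?_
    rw [ht_def, LinearMap.adjoint_inner_left, LinearMap.adjoint_inner_left,
      ← Module.End.mul_apply, h, Module.End.one_apply]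
  have hsq : ‖W v‖ ^ 2 ≤ ‖v‖ * ‖W v‖ :=
    calc ‖W v‖ ^ 2 = ⟪v, t⟫ := by
          rw [← real_inner_self_eq_norm_sq, ← LinearMap.adjoint_inner_right]
      _ ≤ ‖v‖ * ‖t‖ := real_inner_le_norm _ _
      _ ≤ ‖v‖ * ‖W v‖ := by
        gcongr
        exact (hT t).trans_eq (congrArg norm ht)
  nlinarith [norm_nonneg v]

end FiniteSectionInner

section WhiteningFilter

open scoped RealInnerProductSpace Matrix

local notation "toCLM" => Matrix.toEuclideanCLM (𝕜 := ℝ)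

namespace VectorModel

variable {m p : ℕ} (M : VectorModel m p)

/-- The causal inverse of `M.synthesis`: the normalized innovations of an observation path. -/
def whitening : (ℕ → EuclideanSpace ℝ (Fin m)) →L[ℝ] (ℕ → EuclideanSpace ℝ (Fin m)) :=
  ContinuousLinearMap.piMap (fun i => toCLM (M.root i)⁻¹) * (1 - M.predictor)

/-- The Euclidean space of `N` vector observations. -/
abbrev ObsSpace (m N : ℕ) := PiLp 2 fun _ : Fin N => EuclideanSpace ℝ (Fin m)

/-- The synthesis filter on `N` observations, in units of the noise level `σ`. -/
def normalizedSynthesis (N : ℕ) : ObsSpace m N →ₗ[ℝ] ObsSpace m N :=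
  M.σ⁻¹ • finiteSection M.synthesis N

/-- The whitening filter on `N` observations, in units of the noise level `σ`. -/
def normalizedWhitening (N : ℕ) : ObsSpace m N →ₗ[ℝ] ObsSpace m N :=
  M.σ • finiteSection M.whitening N

theorem hasDelay_predictor : HasDelay M.predictor 1 := HasDelay.linearRecursion _ _

theorem hasDelay_resynthesis : HasDelay M.resynthesis 0 :=
  HasDelay.one.add ((HasDelay.linearRecursion _ _).mono zero_le_one)

theorem hasDelay_synthesis : HasDelay M.synthesis 0 :=
  M.hasDelay_resynthesis.mul (HasDelay.piMap _)

theorem hasDelay_whitening : HasDelay M.whitening 0 :=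
  (HasDelay.piMap _).mul (HasDelay.one.sub (M.hasDelay_predictor.mono zero_le_one))

theorem measurable_normalizedSynthesis (N : ℕ) : Measurable (M.normalizedSynthesis N) :=
  ((continuous_finiteSection M.synthesis N).const_smul M.σ⁻¹).measurable

theorem measurable_normalizedWhitening (N : ℕ) : Measurable (M.normalizedWhitening N) :=
  ((continuous_finiteSection M.whitening N).const_smul M.σ).measurable

theorem det_finiteSection_synthesis (N : ℕ) :
    LinearMap.det (finiteSection M.synthesis N) = ∏ i ∈ Finset.range N, (M.root i).det := by
  rw [synthesis, finiteSection_mul M.hasDelay_resynthesis, map_mul, resynthesis,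
    det_finiteSection_one_add (HasDelay.linearRecursion _ _), one_mul, coloring,
    det_finiteSection_piMap]
  refine Finset.prod_congr rfl fun i _ => ?_
  rw [Matrix.coe_toEuclideanCLM_eq_toEuclideanLin, Matrix.toEuclideanLin, Matrix.toLpLin_eq_toLin,
    LinearMap.det_toLin]

theorem adjoint_finiteSection_synthesis {N : ℕ} (t : ℕ → EuclideanSpace ℝ (Fin m)) :
    LinearMap.adjoint (finiteSection M.synthesis N) (firstTerms N t)
      = firstTerms N (M.synthesisAdjoint N t) := by
  refine ext_inner_right ℝ fun v => ?_
  rw [LinearMap.adjoint_inner_left, ← firstTerms_zeroExtend v,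
    finiteSection_firstTerms M.hasDelay_synthesis, inner_firstTerms, inner_firstTerms,
    sum_inner_synthesis]

variable {M}

theorem isUnit_det_root (hσ : 0 < M.σ) (hQ : M.Q.PosSemidef) (hC₀ : M.C₀.PosSemidef) (i : ℕ) :
    IsUnit (M.root i).det := by
  have hRe := isUnit_det_Re hσ (posSemidef_riccatiSeq hσ hQ hC₀ i)
  rw [← root_mul_root hσ hQ hC₀, Matrix.det_mul] at hRe
  exact isUnit_of_mul_isUnit_left hRe

theorem whitening_mul_synthesis (hσ : 0 < M.σ) (hQ : M.Q.PosSemidef) (hC₀ : M.C₀.PosSemidef) :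
    M.whitening * M.synthesis = 1 := by
  rw [whitening, mul_assoc, one_sub_predictor_mul_synthesis]
  ext w i : 2
  change (toCLM (M.root i)⁻¹ * toCLM (M.root i)) (w i) = w i
  rw [← map_mul, Matrix.nonsing_inv_mul _ (isUnit_det_root hσ hQ hC₀ i), map_one]
  rfl

theorem normalizedWhitening_mul_normalizedSynthesis (hσ : 0 < M.σ) (hQ : M.Q.PosSemidef)
    (hC₀ : M.C₀.PosSemidef) (N : ℕ) :
    M.normalizedWhitening N * M.normalizedSynthesis N = 1 := by
  rw [normalizedWhitening, normalizedSynthesis, smul_mul_smul_comm, mul_inv_cancel₀ hσ.ne',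
    one_smul, ← finiteSection_mul M.hasDelay_whitening, whitening_mul_synthesis hσ hQ hC₀,
    finiteSection_one]

theorem log_abs_det_normalizedSynthesis (hσ : 0 < M.σ) (hQ : M.Q.PosSemidef)
    (hC₀ : M.C₀.PosSemidef) (N : ℕ) :
    Real.log |LinearMap.det (M.normalizedSynthesis N)| = ∑ i ∈ Finset.range N,
      -(1 / 2) * Real.log (M.σ ^ (2 * m) / (M.Re (M.riccatiSeq i)).det) := by
  have hroot : ∀ i, (M.root i).det ≠ 0 := fun i => (isUnit_det_root hσ hQ hC₀ i).ne_zero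
  have hterm : ∀ i, -(1 / 2) * Real.log (M.σ ^ (2 * m) / (M.Re (M.riccatiSeq i)).det)
      = Real.log (M.root i).det - m * Real.log M.σ := fun i => by
    rw [← root_mul_root hσ hQ hC₀, Matrix.det_mul, Real.log_div (by positivity)
      (mul_ne_zero (hroot i) (hroot i)), Real.log_mul (hroot i) (hroot i), Real.log_pow]
    push_cast
    ring
  rw [normalizedSynthesis, LinearMap.det_smul, det_finiteSection_synthesis, Real.log_abs,
    Real.log_mul (by positivity) (Finset.prod_ne_zero_iff.2 fun i _ => hroot i), Real.log_pow,
    Real.log_inv, Real.log_prod fun i _ => hroot i, Finset.sum_congr rfl fun i _ => hterm i,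
    Finset.sum_sub_distrib, Finset.sum_const, Finset.card_range,
    (WithLp.linearEquiv 2 ℝ (Fin N → EuclideanSpace ℝ (Fin m))).finrank_eq,
    Module.finrank_pi_fintype]
  simp only [finrank_euclideanSpace_fin, Finset.sum_const, Finset.card_univ, Fintype.card_fin,
    smul_eq_mul, nsmul_eq_mul, Nat.cast_mul]
  ring

theorem norm_le_norm_adjoint_normalizedSynthesis (hσ : 0 < M.σ) (hQ : M.Q.PosSemidef)
    (hC₀ : M.C₀.PosSemidef) {N : ℕ} (v : ObsSpace m N) :
    ‖v‖ ≤ ‖LinearMap.adjoint (M.normalizedSynthesis N) v‖ := by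
  set t := zeroExtend N v
  have hv : firstTerms N t = v := firstTerms_zeroExtend v
  have hinitial : 0 ≤ (M.signalCostate t N 0).ofLp ⬝ᵥ M.C₀ *ᵥ (M.signalCostate t N 0).ofLp :=
    hC₀.dotProduct_mulVec_nonneg _
  have hinput : 0 ≤ ∑ j ∈ Finset.range N, (M.Bᵀ *ᵥ (M.signalCostate t N (j + 1)).ofLp)
      ⬝ᵥ M.Q *ᵥ (M.Bᵀ *ᵥ (M.signalCostate t N (j + 1)).ofLp) :=
    Finset.sum_nonneg fun j _ => hQ.dotProduct_mulVec_nonneg _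
  have hnoise : M.σ ^ 2 * ‖v‖ ^ 2
      ≤ ‖LinearMap.adjoint (finiteSection M.synthesis N) v‖ ^ 2 := by
    rw [← hv, adjoint_finiteSection_synthesis, norm_sq_firstTerms, norm_sq_firstTerms,
      sum_norm_sq_synthesisAdjoint hσ hQ hC₀]
    linarith
  rw [normalizedSynthesis, map_smulₛₗ, LinearMap.smul_apply, norm_smul, conj_trivial,
    Real.norm_of_nonneg (inv_pos.2 hσ).le, ← div_eq_inv_mul, le_div_iff₀' hσ]
  exact abs_le_of_sq_le_sq' (by rwa [mul_pow]) (norm_nonneg _) |>.2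

theorem norm_normalizedWhitening_le (hσ : 0 < M.σ) (hQ : M.Q.PosSemidef) (hC₀ : M.C₀.PosSemidef)
    {N : ℕ} (v : ObsSpace m N) :
    ‖M.normalizedWhitening N v‖ ≤ ‖v‖ :=
  norm_le_of_mul_eq_one_of_norm_le_adjoint
    (normalizedWhitening_mul_normalizedSynthesis hσ hQ hC₀ N)
    (norm_le_norm_adjoint_normalizedSynthesis hσ hQ hC₀) v

theorem normalizedWhitening_firstTerms (N : ℕ) (x : ℕ → EuclideanSpace ℝ (Fin m)) :
    M.normalizedWhitening N (firstTerms N x) = firstTerms N (M.whitening (M.σ • x)) := by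
  rw [normalizedWhitening, LinearMap.smul_apply, finiteSection_firstTerms M.hasDelay_whitening,
    map_smul, map_smul]

end VectorModel

end WhiteningFilter

/-! ### Covariance matrices -/

section CovMatrix

open scoped Matrix

variable {Ω Ω' ι : Type*} [MeasurableSpace Ω] [MeasurableSpace Ω'] {μ : Measure Ω}
  {X Y : Ω → EuclideanSpace ℝ ι}

/-- The covariance matrix of a random vector `X` under `μ`. -/
def covMatrix (X : Ω → EuclideanSpace ℝ ι) (μ : Measure Ω) : Matrix ι ι ℝ :=
  Matrix.of fun a b => cov[fun ω => X ω a, fun ω => X ω b; μ]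

theorem covMatrix_congr (h : X =ᵐ[μ] Y) : covMatrix X μ = covMatrix Y μ := by
  ext a b
  have hcoord : ∀ a, (fun ω => X ω a) =ᵐ[μ] fun ω => Y ω a := fun a =>
    h.fun_comp fun x => x a
  simp only [covMatrix, Matrix.of_apply, covariance, integral_congr_ae (hcoord a),
    integral_congr_ae (hcoord b)]
  exact integral_congr_ae (h.fun_comp fun x => (x a - _) * (x b - _))

theorem covMatrix_map {Z : Ω' → Ω} {ν : Measure Ω'} (hX : Measurable X) (hZ : Measurable Z) :
    covMatrix X (ν.map Z) = covMatrix (fun ω => X (Z ω)) ν := by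
  ext a b
  have hcoord : ∀ a, Measurable fun ω => X ω a := fun a => by fun_prop
  exact covariance_map_fun (hcoord a).aestronglyMeasurable (hcoord b).aestronglyMeasurable
    hZ.aemeasurable

theorem covMatrix_smul (c : ℝ) : covMatrix (fun ω => c • X ω) μ = c ^ 2 • covMatrix X μ := by
  ext a b
  simp only [covMatrix, Matrix.of_apply, Matrix.smul_apply, PiLp.smul_apply, smul_eq_mul,
    covariance_const_mul_left, covariance_const_mul_right]
  ring

variable [Fintype ι]

theorem memLp_euclideanSpace_apply {q : ENNReal} (hX : MemLp X q μ) (a : ι) :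
    MemLp (fun ω => X ω a) q μ :=
  (EuclideanSpace.proj (𝕜 := ℝ) a).comp_memLp' hX

theorem covMatrix_toEuclideanCLM [DecidableEq ι] [IsFiniteMeasure μ] (hX : MemLp X 2 μ)
    (F : Matrix ι ι ℝ) :
    covMatrix (fun ω => Matrix.toEuclideanCLM (𝕜 := ℝ) F (X ω)) μ = F * covMatrix X μ * Fᵀ := by
  ext a b
  have hcoord : ∀ a ω, Matrix.toEuclideanCLM (𝕜 := ℝ) F (X ω) a = ∑ c, F a c * X ω c :=
    fun a ω => by rw [Matrix.ofLp_toEuclideanCLM]; rfl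
  have hterm : ∀ a c, MemLp (fun ω => F a c * X ω c) 2 μ := fun a c =>
    (memLp_euclideanSpace_apply hX c).const_mul _
  simp only [covMatrix, Matrix.of_apply, hcoord, Matrix.mul_apply, Matrix.transpose_apply,
    covariance_fun_sum_fun_sum (hterm a) (hterm b), covariance_const_mul_left,
    covariance_const_mul_right, Finset.sum_mul]
  rw [Finset.sum_comm]
  refine Finset.sum_congr rfl fun c _ => Finset.sum_congr rfl fun d _ => ?_
  ring

theorem covMatrix_add [IsFiniteMeasure μ] (hX : MemLp X 2 μ) (hY : MemLp Y 2 μ)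
    (h : IndepFun X Y μ) :
    covMatrix (fun ω => X ω + Y ω) μ = covMatrix X μ + covMatrix Y μ := by
  ext a b
  have hXc := memLp_euclideanSpace_apply hX
  have hYc := memLp_euclideanSpace_apply hY
  have hcross : ∀ a b, cov[fun ω => X ω a, fun ω => Y ω b; μ] = 0 := fun a b =>
    IndepFun.covariance_eq_zero (h.comp (φ := fun x : EuclideanSpace ℝ ι => x a)
      (ψ := fun x : EuclideanSpace ℝ ι => x b) (by fun_prop) (by fun_prop)) (hXc a) (hYc b)
  have hadd : ∀ a, (fun ω => X ω a + Y ω a) = (fun ω => X ω a) + fun ω => Y ω a := fun a => rfl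
  simp only [covMatrix, Matrix.of_apply, Matrix.add_apply, PiLp.add_apply]
  rw [hadd a, hadd b, covariance_add_left (hXc a) (hYc a) ((hXc b).add (hYc b)),
    covariance_add_right (hXc a) (hXc b) (hYc b), covariance_add_right (hYc a) (hXc b) (hYc b),
    hcross a b, covariance_comm (fun ω => Y ω a), hcross b a, add_zero, zero_add]

theorem covMatrix_sub [IsFiniteMeasure μ] (hX : MemLp X 2 μ) (hY : MemLp Y 2 μ)
    (h : IndepFun X Y μ) :
    covMatrix (fun ω => X ω - Y ω) μ = covMatrix X μ + covMatrix Y μ :=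
  calc covMatrix (fun ω => X ω - Y ω) μ = covMatrix (fun ω => X ω + (-1 : ℝ) • Y ω) μ := by
        simp only [neg_smul, one_smul, sub_eq_add_neg]
    _ = covMatrix X μ + covMatrix (fun ω => (-1 : ℝ) • Y ω) μ :=
        covMatrix_add hX (hY.const_smul (-1 : ℝ))
          (h.comp measurable_id (measurable_const_smul (-1 : ℝ)))
    _ = covMatrix X μ + covMatrix Y μ := by rw [covMatrix_smul, neg_one_sq, one_smul]

theorem integral_norm_sq_eq_trace_covMatrix [IsProbabilityMeasure μ] (hX : MemLp X 2 μ)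
    (hmean : ∫ ω, X ω ∂μ = 0) : ∫ ω, ‖X ω‖ ^ 2 ∂μ = (covMatrix X μ).trace := by
  have hXc := memLp_euclideanSpace_apply hX
  have hcoord : ∀ a, ∫ ω, X ω a ∂μ = 0 := fun a => by
    rw [← (EuclideanSpace.proj (𝕜 := ℝ) a).map_zero, ← hmean,
      ← ContinuousLinearMap.integral_comp_comm _ (hX.integrable one_le_two)]
    rfl
  simp_rw [EuclideanSpace.real_norm_sq_eq]
  rw [integral_finsetSum _ fun a _ => (hXc a).integrable_sq, Matrix.trace]
  refine Finset.sum_congr rfl fun a _ => ?_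
  rw [Matrix.diag_apply, covMatrix, Matrix.of_apply, covariance_eq_sub (hXc a) (hXc a), hcoord,
    zero_mul, sub_zero]
  simp only [pow_two, Pi.mul_apply]

end CovMatrix

section CausalFunctionsOfNoise

open scoped RealInnerProductSpace

variable {E : Type*} [NormedAddCommGroup E] [InnerProductSpace ℝ E] [FiniteDimensional ℝ E]
  [MeasurableSpace E] [BorelSpace E] {T : (ℕ → E) →L[ℝ] (ℕ → E)}

theorem measurePreserving_firstTerms_stdNoise (N : ℕ) :
    MeasurePreserving (firstTerms N) (stdNoise E) (stdGaussian (PiLp 2 fun _ : Fin N => E)) := by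
  have hmeas : Measurable (firstTerms N : (ℕ → E) →L[ℝ] PiLp 2 fun _ : Fin N => E) :=
    (firstTerms N).continuous.measurable
  have := Measure.isProbabilityMeasure_map (μ := stdNoise E) hmeas.aemeasurable
  refine ⟨hmeas, Measure.ext_of_charFun (funext fun t => ?_)⟩
  rw [charFun_stdGaussian, ← firstTerms_zeroExtend t, charFun_apply,
    integral_map hmeas.aemeasurable (by fun_prop)]
  simp only [inner_firstTerms, real_inner_comm (zeroExtend N t _)]
  refine (seqCharFun_stdNoise E N (zeroExtend N t)).trans ?_
  rw [← norm_sq_firstTerms, Complex.ofReal_pow]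

theorem memLp_apply_stdNoise (hT : HasDelay T 0) (i : ℕ) :
    MemLp (fun w => T w i) 2 (stdNoise E) := by
  obtain ⟨L, hL⟩ := hT.exists_apply_eq_firstTerms i
  simp only [hL]
  exact (L.comp_memLp' IsGaussian.memLp_two_id).comp_measurePreserving
    (measurePreserving_firstTerms_stdNoise (i + 1))

theorem memLp_eval_stdNoise (i : ℕ) : MemLp (fun w => w i) 2 (stdNoise E) :=
  memLp_apply_stdNoise HasDelay.one i

theorem integral_apply_stdNoise (hT : HasDelay T 0) (i : ℕ) :
    ∫ w, T w i ∂stdNoise E = 0 := by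
  obtain ⟨L, hL⟩ := hT.exists_apply_eq_firstTerms i
  have hlaw := measurePreserving_firstTerms_stdNoise (E := E) (i + 1)
  simp only [hL]
  rw [← integral_map hlaw.aemeasurable L.continuous.aestronglyMeasurable, hlaw.map_eq,
    L.integral_comp_id_comm IsGaussian.integrable_id, integral_id_stdGaussian, map_zero]

theorem indepFun_eval_firstTerms_stdNoise (i : ℕ) :
    IndepFun (fun w => w i) (firstTerms i) (stdNoise E) := by
  have hcoord : iIndepFun (fun (i : ℕ) (w : ℕ → E) => w i) (stdNoise E) :=
    iIndepFun_infinitePi (X := fun (_ : ℕ) (x : E) => x) fun _ => measurable_id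
  exact (hcoord.indepFun_finset {i} (Finset.range i) (by simp) measurable_pi_apply).comp
    (φ := fun x : ({i} : Finset ℕ) → E => x ⟨i, Finset.mem_singleton_self i⟩)
    (ψ := fun x : Finset.range i → E =>
      WithLp.toLp 2 fun j : Fin i => x ⟨j, Finset.mem_range.2 j.2⟩)
    (by fun_prop) (by fun_prop)

theorem indepFun_eval_apply_stdNoise (hT : HasDelay T 1) (i : ℕ) :
    IndepFun (fun w => w i) (fun w => T w i) (stdNoise E) := by
  have h := (indepFun_eval_firstTerms_stdNoise (E := E) i).comp (φ := id)
    (ψ := fun v => T (zeroExtend i v) i) measurable_id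
    ((measurable_pi_apply i).comp (T.continuous.comp (continuous_zeroExtend i)).measurable)
  simpa only [Function.comp_def, id_eq, hT.apply_zeroExtend_firstTerms i.lt_succ_self] using h

theorem covMatrix_eval_stdNoise {ι : Type*} [Fintype ι] [DecidableEq ι] (i : ℕ) :
    covMatrix (fun w => w i) (stdNoise (EuclideanSpace ℝ ι)) = 1 := by
  rw [← covMatrix_map (X := fun x => x) measurable_id (by fun_prop), stdNoise,
    (measurePreserving_eval_infinitePi _ i).map_eq, ← multivariateGaussian_zero_one]
  ext a b
  exact covariance_eval_multivariateGaussian Matrix.PosSemidef.one a b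

theorem integral_norm_sq_eval_stdNoise {ι : Type*} [Fintype ι] (i : ℕ) :
    ∫ w, ‖w i‖ ^ 2 ∂stdNoise (EuclideanSpace ℝ ι) = Fintype.card ι := by
  classical
  have hmean : ∫ w, w i ∂stdNoise (EuclideanSpace ℝ ι) = 0 :=
    integral_apply_stdNoise HasDelay.one i
  rw [integral_norm_sq_eq_trace_covMatrix (memLp_eval_stdNoise i) hmean, covMatrix_eval_stdNoise,
    Matrix.trace_one]

end CausalFunctionsOfNoise

section NullPredictor

open scoped Matrix

local notation "toCLM" => Matrix.toEuclideanCLM (𝕜 := ℝ)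

namespace VectorModel

variable {m p : ℕ} (M : VectorModel m p)

/-- The covariance of the prediction at time `i` when the observations are a standard white
noise. -/
def nullPredictorCov (i : ℕ) : Matrix (Fin m) (Fin m) ℝ :=
  covMatrix (fun w => M.predictor w i) (stdNoise (EuclideanSpace ℝ (Fin m)))

theorem predictor_apply_succ (y : ℕ → EuclideanSpace ℝ (Fin m)) (i : ℕ) :
    M.predictor y (i + 1)
      = toCLM (M.A - M.gain i) (M.predictor y i) + toCLM (M.gain i) (y i) := by
  rw [predictor, linearRecursion_apply_succ, map_sub]

theorem nullPredictorCov_succ (i : ℕ) :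
    M.nullPredictorCov (i + 1)
      = (M.A - M.gain i) * M.nullPredictorCov i * (M.A - M.gain i)ᵀ
        + M.gain i * (M.gain i)ᵀ := by
  have hpred := memLp_apply_stdNoise (M.hasDelay_predictor.mono zero_le_one) i
  have heval := memLp_eval_stdNoise (E := EuclideanSpace ℝ (Fin m)) i
  have hind := (indepFun_eval_apply_stdNoise M.hasDelay_predictor i).symm.comp
    (φ := toCLM (M.A - M.gain i)) (ψ := toCLM (M.gain i)) (by fun_prop) (by fun_prop)
  simp only [nullPredictorCov, predictor_apply_succ]
  refine (covMatrix_add ((toCLM (M.A - M.gain i)).comp_memLp' hpred)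
    ((toCLM (M.gain i)).comp_memLp' heval) hind).trans ?_
  refine congrArg₂ _ (covMatrix_toEuclideanCLM hpred _)
    ((covMatrix_toEuclideanCLM heval _).trans ?_)
  rw [covMatrix_eval_stdNoise, mul_one]

theorem covMatrix_one_sub_predictor_stdNoise (i : ℕ) :
    covMatrix (fun w => (1 - M.predictor) w i) (stdNoise (EuclideanSpace ℝ (Fin m)))
      = 1 + M.nullPredictorCov i :=
  (covMatrix_sub (memLp_eval_stdNoise i)
    (memLp_apply_stdNoise (M.hasDelay_predictor.mono zero_le_one) i)
    (indepFun_eval_apply_stdNoise M.hasDelay_predictor i)).trans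
    (congrArg (· + M.nullPredictorCov i) (covMatrix_eval_stdNoise i))

variable {M}

theorem tendsto_nullPredictorCov {P P' : Matrix (Fin m) (Fin m) ℝ}
    (hP : IsUnit (M.Re P).det) (hlim : Tendsto M.riccatiSeq atTop (𝓝 P))
    (hstab : IsStableMatrix (M.A - M.Kp P)) (hP' : M.IsLyapunovSolution P P') :
    Tendsto M.nullPredictorCov atTop (𝓝 P') := by
  have hK : Tendsto M.gain atTop (𝓝 (M.Kp P)) := tendsto_Kp hP hlim
  have hKt : Tendsto (fun i => (M.gain i)ᵀ) atTop (𝓝 (M.Kp P)ᵀ) :=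
    (continuous_id.matrix_transpose.tendsto _).comp hK
  exact hstab.tendsto_lyapunov hP'.lyapunov (hK.const_sub M.A) (hK.mul hKt)
    M.nullPredictorCov_succ

end VectorModel

end NullPredictor

/-! ### The innovation process -/

section Conditioning

variable {Ω Ω' E F : Type*} [MeasurableSpace Ω] [MeasurableSpace Ω'] {μ ν : Measure Ω}

theorem indepFun_map [MeasurableSpace E] [MeasurableSpace F] {ρ : Measure Ω'} {Z : Ω' → Ω}
    {X : Ω → E} {Y : Ω → F} (hZ : Measurable Z) (hX : Measurable X) (hY : Measurable Y)
    (h : IndepFun (X ∘ Z) (Y ∘ Z) ρ) : IndepFun X Y (ρ.map Z) := by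
  rw [indepFun_iff_measure_inter_preimage_eq_mul] at h ⊢
  intro s t hs ht
  rw [Measure.map_apply hZ ((hX hs).inter (hY ht)), Measure.map_apply hZ (hX hs),
    Measure.map_apply hZ (hY ht)]
  exact h s t hs ht

theorem ae_eq_of_map_absolutelyContinuous [MeasurableSpace F] [TopologicalSpace E]
    [TopologicalSpace.MetrizableSpace E] {Z : Ω → F} (hZ : Measurable Z) (h : μ.map Z ≪ ν.map Z)
    {X Y : Ω → E} (hX : StronglyMeasurable[MeasurableSpace.comap Z inferInstance] X)
    (hY : StronglyMeasurable[MeasurableSpace.comap Z inferInstance] Y) (hXY : X =ᵐ[ν] Y) :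
    X =ᵐ[μ] Y := by
  obtain ⟨s, hs, hpre⟩ := StronglyMeasurable.measurableSet_eq_fun hX hY
  have hν : s ∈ ae (ν.map Z) := by
    rw [mem_ae_map_iff hZ.aemeasurable hs, hpre]
    exact hXY
  have hμ := h.ae_le hν
  rwa [mem_ae_map_iff hZ.aemeasurable hs, hpre] at hμ

variable [NormedAddCommGroup E] [NormedSpace ℝ E] [CompleteSpace E] [MeasurableSpace E]
  [BorelSpace E] [SecondCountableTopology E] [MeasurableSpace F] [IsFiniteMeasure μ]

theorem condExp_comap_ae_eq_of_indepFun_sub {Z : Ω → F} {X Y : Ω → E} (hZ : Measurable Z)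
    (hX : Measurable X) (hXint : Integrable X μ) (hYint : Integrable Y μ)
    (hY : StronglyMeasurable[MeasurableSpace.comap Z inferInstance] Y)
    (hind : IndepFun (X - Y) Z μ) (hmean : ∫ ω, (X - Y) ω ∂μ = 0) :
    μ[X | MeasurableSpace.comap Z inferInstance] =ᵐ[μ] Y := by
  have hsub : Measurable (X - Y) := hX.sub (hY.mono hZ.comap_le).measurable
  have hadd := condExp_add hYint (hXint.sub hYint) (MeasurableSpace.comap Z inferInstance)
  rw [add_sub_cancel, condExp_of_stronglyMeasurable hZ.comap_le hY hYint] at hadd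
  have hzero := condExp_indep_eq hsub.comap_le hZ.comap_le
    (comap_measurable (X - Y)).stronglyMeasurable hind
  filter_upwards [hadd, hzero] with ω hω hω'
  rw [hω, Pi.add_apply, hω', hmean, add_zero]

end Conditioning

section InnovationProcess

local notation "toCLM" => Matrix.toEuclideanCLM (𝕜 := ℝ)

namespace VectorModel

variable {m p : ℕ}

theorem past_eq_comap_firstTerms (m i : ℕ) :
    past m i = MeasurableSpace.comap
      (firstTerms i : (ℕ → EuclideanSpace ℝ (Fin m)) →L[ℝ] ObsSpace m i) inferInstance :=
  (MeasurableSpace.comap_comp (f := WithLp.ofLp) (g := firstTerms i)).symm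

variable (M : VectorModel m p)

theorem measurable_one_sub_predictor (i : ℕ) : Measurable fun y => (1 - M.predictor) y i :=
  (measurable_pi_apply i).comp (1 - M.predictor).continuous.measurable

theorem stronglyMeasurable_predictor (i : ℕ) :
    StronglyMeasurable[past m i] fun y => M.predictor y i := by
  have hmeas : Measurable fun v => M.predictor (zeroExtend i v) i :=
    (measurable_pi_apply i).comp (M.predictor.continuous.comp (continuous_zeroExtend i)).measurable
  have hcomp := (hmeas.comp (comap_measurable (firstTerms i))).stronglyMeasurable
  rw [past_eq_comap_firstTerms]
  simpa only [Function.comp_def, M.hasDelay_predictor.apply_zeroExtend_firstTerms i.lt_succ_self]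
    using hcomp

theorem one_sub_predictor_synthesis (w : ℕ → EuclideanSpace ℝ (Fin m)) (i : ℕ) :
    (1 - M.predictor) (M.synthesis w) i = toCLM (M.root i) (w i) :=
  congrFun (congrArg (· w) M.one_sub_predictor_mul_synthesis) i

variable {M}

theorem integrable_apply_lawH1 (hσ : 0 < M.σ) (hQ : M.Q.PosSemidef) (hC₀ : M.C₀.PosSemidef)
    {T : (ℕ → EuclideanSpace ℝ (Fin m)) →L[ℝ] (ℕ → EuclideanSpace ℝ (Fin m))}
    (hT : HasDelay T 0) (i : ℕ) : Integrable (fun y => T y i) M.lawH1 := by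
  have hmeas : Measurable fun y => T y i := (measurable_pi_apply i).comp T.continuous.measurable
  rw [lawH1_eq_map_stdNoise hσ hQ hC₀, integrable_map_measure hmeas.aestronglyMeasurable
    M.synthesis.continuous.aemeasurable]
  exact (memLp_apply_stdNoise (hT.mul M.hasDelay_synthesis) i).integrable one_le_two

theorem integral_one_sub_predictor_lawH1 (hσ : 0 < M.σ) (hQ : M.Q.PosSemidef)
    (hC₀ : M.C₀.PosSemidef) (i : ℕ) : ∫ y, (1 - M.predictor) y i ∂M.lawH1 = 0 := by
  rw [lawH1_eq_map_stdNoise hσ hQ hC₀, integral_map M.synthesis.continuous.aemeasurable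
    (M.measurable_one_sub_predictor i).aestronglyMeasurable]
  simp only [one_sub_predictor_synthesis]
  exact integral_apply_stdNoise (HasDelay.piMap fun i => toCLM (M.root i)) i

theorem indepFun_one_sub_predictor_firstTerms_lawH1 (hσ : 0 < M.σ) (hQ : M.Q.PosSemidef)
    (hC₀ : M.C₀.PosSemidef) (i : ℕ) :
    IndepFun (fun y => (1 - M.predictor) y i) (firstTerms i) M.lawH1 := by
  rw [lawH1_eq_map_stdNoise hσ hQ hC₀]
  refine indepFun_map M.synthesis.continuous.measurable (M.measurable_one_sub_predictor i)
    (firstTerms i).continuous.measurable ?_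
  have h := (indepFun_eval_firstTerms_stdNoise (E := EuclideanSpace ℝ (Fin m)) i).comp
    (φ := toCLM (M.root i)) (ψ := finiteSection M.synthesis i) (by fun_prop)
    (continuous_finiteSection M.synthesis i).measurable
  simpa only [Function.comp_def, finiteSection_firstTerms M.hasDelay_synthesis,
    one_sub_predictor_synthesis] using h

theorem condExp_lawH1 (hσ : 0 < M.σ) (hQ : M.Q.PosSemidef) (hC₀ : M.C₀.PosSemidef) (i : ℕ) :
    M.lawH1[fun y => y i | past m i] =ᵐ[M.lawH1] fun y => M.predictor y i := by
  have hpred := M.stronglyMeasurable_predictor i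
  rw [past_eq_comap_firstTerms] at hpred ⊢
  exact condExp_comap_ae_eq_of_indepFun_sub (firstTerms i).continuous.measurable
    (measurable_pi_apply i) (integrable_apply_lawH1 hσ hQ hC₀ HasDelay.one i)
    (integrable_apply_lawH1 hσ hQ hC₀ (M.hasDelay_predictor.mono zero_le_one) i) hpred
    (indepFun_one_sub_predictor_firstTerms_lawH1 hσ hQ hC₀ i)
    (integral_one_sub_predictor_lawH1 hσ hQ hC₀ i)

theorem map_firstTerms_lawH0 (N : ℕ) :
    M.lawH0.map (firstTerms N) = (stdGaussian (ObsSpace m N)).map (M.σ • ·) := by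
  have hfirst := (firstTerms N : (ℕ → EuclideanSpace ℝ (Fin m)) →L[ℝ] _).continuous.measurable
  rw [lawH0_eq_map_stdNoise, ← (measurePreserving_firstTerms_stdNoise N).map_eq,
    Measure.map_map hfirst (measurable_const_smul _),
    Measure.map_map (measurable_const_smul _) hfirst]
  rfl

theorem map_firstTerms_lawH1 (hσ : 0 < M.σ) (hQ : M.Q.PosSemidef) (hC₀ : M.C₀.PosSemidef)
    (N : ℕ) : M.lawH1.map (firstTerms N)
      = ((stdGaussian (ObsSpace m N)).map (M.normalizedSynthesis N)).map (M.σ • ·) := by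
  have hfirst := (firstTerms N : (ℕ → EuclideanSpace ℝ (Fin m)) →L[ℝ] _).continuous.measurable
  have hsynth := M.measurable_normalizedSynthesis N
  rw [lawH1_eq_map_stdNoise hσ hQ hC₀, ← (measurePreserving_firstTerms_stdNoise N).map_eq,
    Measure.map_map hfirst M.synthesis.continuous.measurable,
    Measure.map_map (measurable_const_smul _) hsynth,
    Measure.map_map ((measurable_const_smul _).comp hsynth) hfirst]
  refine congrArg (Measure.map · _) (funext fun w => ?_)
  simp only [Function.comp_apply, normalizedSynthesis, LinearMap.smul_apply,
    finiteSection_firstTerms M.hasDelay_synthesis, smul_inv_smul₀ hσ.ne']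

theorem map_firstTerms_lawH0_absolutelyContinuous (hσ : 0 < M.σ) (hQ : M.Q.PosSemidef)
    (hC₀ : M.C₀.PosSemidef) (N : ℕ) :
    M.lawH0.map (firstTerms N) ≪ M.lawH1.map (firstTerms N) := by
  rw [map_firstTerms_lawH0, map_firstTerms_lawH1 hσ hQ hC₀,
    stdGaussian_map_linearMap (normalizedWhitening_mul_normalizedSynthesis hσ hQ hC₀ N)]
  have hwhite := M.measurable_normalizedWhitening N
  exact (withDensity_absolutelyContinuous' (by fun_prop) (ae_of_all _ fun v =>
    (ENNReal.ofReal_pos.2 (Real.exp_pos _)).ne')).map (measurable_const_smul _)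

theorem innovation_ae_eq_lawH1 (hσ : 0 < M.σ) (hQ : M.Q.PosSemidef) (hC₀ : M.C₀.PosSemidef)
    (i : ℕ) : M.innovation i =ᵐ[M.lawH1] fun y => (1 - M.predictor) y i := by
  filter_upwards [condExp_lawH1 hσ hQ hC₀ i] with y hy
  rw [innovation, hy]
  rfl

theorem innovation_ae_eq_lawH0 (hσ : 0 < M.σ) (hQ : M.Q.PosSemidef) (hC₀ : M.C₀.PosSemidef)
    (i : ℕ) : M.innovation i =ᵐ[M.lawH0] fun y => (1 - M.predictor) y i := by
  have hcond : StronglyMeasurable[past m i] (M.lawH1[fun y => y i | past m i]) :=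
    stronglyMeasurable_condExp
  have hpred := M.stronglyMeasurable_predictor i
  have hae := condExp_lawH1 hσ hQ hC₀ i
  rw [past_eq_comap_firstTerms] at hcond hpred hae
  filter_upwards [ae_eq_of_map_absolutelyContinuous (firstTerms i).continuous.measurable
    (map_firstTerms_lawH0_absolutelyContinuous hσ hQ hC₀ i) hcond hpred hae] with y hy
  rw [innovation, past_eq_comap_firstTerms, hy]
  rfl

theorem innovationCov_lawH1 (hσ : 0 < M.σ) (hQ : M.Q.PosSemidef) (hC₀ : M.C₀.PosSemidef)
    (i : ℕ) : M.innovationCov M.lawH1 i = M.Re (M.riccatiSeq i) :=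
  calc M.innovationCov M.lawH1 i = covMatrix (fun y => (1 - M.predictor) y i) M.lawH1 :=
        covMatrix_congr (innovation_ae_eq_lawH1 hσ hQ hC₀ i)
    _ = covMatrix (fun w => toCLM (M.root i) (w i)) (stdNoise _) := by
        rw [lawH1_eq_map_stdNoise hσ hQ hC₀, covMatrix_map (M.measurable_one_sub_predictor i)
          M.synthesis.continuous.measurable]
        simp only [one_sub_predictor_synthesis]
    _ = M.root i * (M.root i).transpose := by
        rw [covMatrix_toEuclideanCLM (memLp_eval_stdNoise i), covMatrix_eval_stdNoise, mul_one]
    _ = M.Re (M.riccatiSeq i) := by rw [transpose_root, root_mul_root hσ hQ hC₀]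

theorem innovationCov_lawH0 (hσ : 0 < M.σ) (hQ : M.Q.PosSemidef) (hC₀ : M.C₀.PosSemidef)
    (i : ℕ) : M.innovationCov M.lawH0 i = M.ReTilde (M.nullPredictorCov i) :=
  calc M.innovationCov M.lawH0 i = covMatrix (fun y => (1 - M.predictor) y i) M.lawH0 :=
        covMatrix_congr (innovation_ae_eq_lawH0 hσ hQ hC₀ i)
    _ = covMatrix (fun w => M.σ • (1 - M.predictor) w i) (stdNoise _) := by
        rw [lawH0_eq_map_stdNoise, covMatrix_map (M.measurable_one_sub_predictor i)
          (measurable_const_smul _)]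
        simp only [map_smul, Pi.smul_apply]
    _ = M.ReTilde (M.nullPredictorCov i) := by
        rw [covMatrix_smul, covMatrix_one_sub_predictor_stdNoise, ReTilde]

end VectorModel

end InnovationProcess

/-! ### The log-likelihood ratio and the error exponent -/

section LogLikelihood

local notation "toCLM" => Matrix.toEuclideanCLM (𝕜 := ℝ)

namespace VectorModel

variable {m p : ℕ} (M : VectorModel m p)

/-- The log-likelihood ratio of `H₀` against `H₁` for `N` observations, as a function of the
observations in units of the noise level `σ`. -/
def logLikelihoodRatio (N : ℕ) (v : ObsSpace m N) : ℝ :=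
  Real.log |LinearMap.det (M.normalizedSynthesis N)|
    + (‖M.normalizedWhitening N v‖ ^ 2 - ‖v‖ ^ 2) / 2

theorem measurable_logLikelihoodRatio (N : ℕ) : Measurable (M.logLikelihoodRatio N) := by
  have hwhite := M.measurable_normalizedWhitening N
  unfold logLikelihoodRatio
  fun_prop

variable {M}

theorem stdGaussian_map_normalizedSynthesis (hσ : 0 < M.σ) (hQ : M.Q.PosSemidef)
    (hC₀ : M.C₀.PosSemidef) (N : ℕ) :
    (stdGaussian (ObsSpace m N)).map (M.normalizedSynthesis N)
      = (stdGaussian (ObsSpace m N)).withDensity fun v =>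
        ENNReal.ofReal (Real.exp (-M.logLikelihoodRatio N v)) :=
  stdGaussian_map_linearMap (normalizedWhitening_mul_normalizedSynthesis hσ hQ hC₀ N)

theorem logLikelihoodRatio_firstTerms (hσ : 0 < M.σ) (hQ : M.Q.PosSemidef)
    (hC₀ : M.C₀.PosSemidef) (N : ℕ) (w : ℕ → EuclideanSpace ℝ (Fin m)) :
    M.logLikelihoodRatio N (firstTerms N w) = ∑ i ∈ Finset.range N,
      (-(1 / 2) * Real.log (M.σ ^ (2 * m) / (M.Re (M.riccatiSeq i)).det)
        + (‖M.whitening (M.σ • w) i‖ ^ 2 - ‖w i‖ ^ 2) / 2) := by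
  rw [logLikelihoodRatio, log_abs_det_normalizedSynthesis hσ hQ hC₀,
    normalizedWhitening_firstTerms, norm_sq_firstTerms, norm_sq_firstTerms,
    ← Finset.sum_sub_distrib, Finset.sum_div, ← Finset.sum_add_distrib]

theorem memLp_whitening_smul_stdNoise (i : ℕ) :
    MemLp (fun w => M.whitening (M.σ • w) i) 2 (stdNoise (EuclideanSpace ℝ (Fin m))) := by
  simp only [map_smul, Pi.smul_apply]
  exact (memLp_apply_stdNoise M.hasDelay_whitening i).const_smul M.σ

theorem integral_norm_sq_whitening_smul_stdNoise (hσ : 0 < M.σ) (hQ : M.Q.PosSemidef)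
    (hC₀ : M.C₀.PosSemidef) (i : ℕ) :
    ∫ w, ‖M.whitening (M.σ • w) i‖ ^ 2 ∂stdNoise (EuclideanSpace ℝ (Fin m))
      = ((M.Re (M.riccatiSeq i))⁻¹ * M.ReTilde (M.nullPredictorCov i)).trace := by
  have hinnov : HasDelay (1 - M.predictor) 0 :=
    HasDelay.one.sub (M.hasDelay_predictor.mono zero_le_one)
  have hcov : covMatrix (fun w => M.whitening w i) (stdNoise _)
      = (M.root i)⁻¹ * (1 + M.nullPredictorCov i) * ((M.root i)⁻¹).transpose := by
    rw [← covMatrix_one_sub_predictor_stdNoise]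
    exact covMatrix_toEuclideanCLM (memLp_apply_stdNoise hinnov i) _
  have hmean : ∫ w, M.whitening w i ∂stdNoise (EuclideanSpace ℝ (Fin m)) = 0 :=
    integral_apply_stdNoise M.hasDelay_whitening i
  calc ∫ w, ‖M.whitening (M.σ • w) i‖ ^ 2 ∂stdNoise _
      = M.σ ^ 2 * ∫ w, ‖M.whitening w i‖ ^ 2 ∂stdNoise _ := by
        rw [← integral_const_mul]
        simp only [map_smul, Pi.smul_apply, norm_smul, mul_pow, Real.norm_eq_abs, sq_abs]
    _ = M.σ ^ 2 * ((M.root i)⁻¹ * (1 + M.nullPredictorCov i) * (M.root i)⁻¹).trace := by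
        rw [integral_norm_sq_eq_trace_covMatrix (memLp_apply_stdNoise M.hasDelay_whitening i)
          hmean, hcov, Matrix.transpose_nonsing_inv, transpose_root]
    _ = ((M.Re (M.riccatiSeq i))⁻¹ * M.ReTilde (M.nullPredictorCov i)).trace := by
        rw [Matrix.trace_mul_comm, ← mul_assoc, ← Matrix.mul_inv_rev, root_mul_root hσ hQ hC₀,
          ReTilde, Matrix.mul_smul, Matrix.trace_smul, smul_eq_mul]

theorem integral_logLikelihoodRatio (hσ : 0 < M.σ) (hQ : M.Q.PosSemidef) (hC₀ : M.C₀.PosSemidef)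
    (N : ℕ) : ∫ v, M.logLikelihoodRatio N v ∂stdGaussian (ObsSpace m N)
      = ∑ i ∈ Finset.range N, M.errorExponent (M.riccatiSeq i) (M.nullPredictorCov i) := by
  have hlaw := measurePreserving_firstTerms_stdNoise (E := EuclideanSpace ℝ (Fin m)) N
  have hwhite : ∀ i, Integrable (fun w => ‖M.whitening (M.σ • w) i‖ ^ 2) (stdNoise _) := fun i =>
    (memLp_whitening_smul_stdNoise i).integrable_norm_pow two_ne_zero
  have hnoise : ∀ i, Integrable (fun w => ‖w i‖ ^ 2) (stdNoise (EuclideanSpace ℝ (Fin m))) :=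
    fun i => (memLp_eval_stdNoise i).integrable_norm_pow two_ne_zero
  have hdiff : ∀ i, Integrable (fun w => (‖M.whitening (M.σ • w) i‖ ^ 2 - ‖w i‖ ^ 2) / 2)
      (stdNoise _) := fun i => ((hwhite i).sub (hnoise i)).div_const 2
  rw [← hlaw.map_eq, integral_map hlaw.aemeasurable
    (M.measurable_logLikelihoodRatio N).aestronglyMeasurable]
  simp only [logLikelihoodRatio_firstTerms hσ hQ hC₀]
  rw [integral_finsetSum _ fun i _ => by exact (integrable_const _).add (hdiff i)]
  refine Finset.sum_congr rfl fun i _ => ?_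
  rw [integral_add (integrable_const _) (hdiff i), integral_const, integral_div,
    integral_sub (hwhite i) (hnoise i), integral_norm_sq_whitening_smul_stdNoise hσ hQ hC₀,
    integral_norm_sq_eval_stdNoise, Fintype.card_fin, errorExponent, probReal_univ, one_smul]
  ring

theorem memLp_logLikelihoodRatio (N : ℕ) :
    MemLp (M.logLikelihoodRatio N) 2 (stdGaussian (ObsSpace m N)) :=
  memLp_add_half_norm_sq_sub_stdGaussian _ _

theorem variance_logLikelihoodRatio_le (hσ : 0 < M.σ) (hQ : M.Q.PosSemidef)
    (hC₀ : M.C₀.PosSemidef) (N : ℕ) :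
    Var[M.logLikelihoodRatio N; stdGaussian (ObsSpace m N)]
      ≤ N * (m * ((1 / 2) ^ 2 * Var[fun x : ℝ => x ^ 2; gaussianReal 0 1])) := by
  refine (variance_add_half_norm_sq_sub_stdGaussian_le
    (norm_normalizedWhitening_le hσ hQ hC₀) _).trans_eq ?_
  rw [(WithLp.linearEquiv 2 ℝ (Fin N → EuclideanSpace ℝ (Fin m))).finrank_eq,
    Module.finrank_pi_fintype]
  simp only [finrank_euclideanSpace_fin, Finset.sum_const, Finset.card_univ, Fintype.card_fin,
    smul_eq_mul, Nat.cast_mul, mul_assoc]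

theorem tendsto_errorExponent {P P' : Matrix (Fin m) (Fin m) ℝ} (hσ : 0 < M.σ)
    (hP : P.PosSemidef) (hlim : Tendsto M.riccatiSeq atTop (𝓝 P))
    (hstab : IsStableMatrix (M.A - M.Kp P)) (hP' : M.IsLyapunovSolution P P') :
    Tendsto (fun i => M.errorExponent (M.riccatiSeq i) (M.nullPredictorCov i)) atTop
      (𝓝 (M.errorExponent P P')) := by
  have hRe := isUnit_det_Re hσ hP
  have hdet : Tendsto (fun i => (M.Re (M.riccatiSeq i)).det) atTop (𝓝 (M.Re P).det) :=
    (continuous_id.matrix_det.tendsto _).comp (hlim.const_add _)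
  have hlog : Tendsto (fun i => Real.log (M.σ ^ (2 * m) / (M.Re (M.riccatiSeq i)).det)) atTop
      (𝓝 (Real.log (M.σ ^ (2 * m) / (M.Re P).det))) :=
    (tendsto_const_nhds.div hdet hRe.ne_zero).log (div_ne_zero (by positivity) hRe.ne_zero)
  have hReTilde : Tendsto (fun i => M.ReTilde (M.nullPredictorCov i)) atTop (𝓝 (M.ReTilde P')) :=
    ((tendsto_nullPredictorCov hRe hlim hstab hP').const_add 1).const_smul (M.σ ^ 2)
  have htrace : Tendsto (fun i => ((M.Re (M.riccatiSeq i))⁻¹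
      * M.ReTilde (M.nullPredictorCov i)).trace) atTop (𝓝 ((M.Re P)⁻¹ * M.ReTilde P').trace) :=
    (continuous_id.matrix_trace.tendsto _).comp ((tendsto_inv_Re hRe hlim).mul hReTilde)
  exact ((hlog.const_mul _).add (htrace.const_mul _)).sub_const _

end VectorModel

end LogLikelihood

namespace VectorModel

variable {m p : ℕ} {M : VectorModel m p}

theorem falseAlarmProb_eq_integral_stdGaussian {N : ℕ}
    {φ : (Fin N → EuclideanSpace ℝ (Fin m)) → ℝ} (hφ : Measurable φ) :
    M.falseAlarmProb φ = ∫ v : ObsSpace m N, φ (M.σ • v).ofLp ∂stdGaussian _ := by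
  have hfirst := (firstTerms N : (ℕ → EuclideanSpace ℝ (Fin m)) →L[ℝ] _).continuous.measurable
  have hφ' : Measurable fun v : ObsSpace m N => φ v.ofLp := hφ.comp (by fun_prop)
  rw [← integral_map (f := fun v : ObsSpace m N => φ v.ofLp)
    (measurable_const_smul M.σ).aemeasurable hφ'.aestronglyMeasurable,
    ← map_firstTerms_lawH0, integral_map hfirst.aemeasurable hφ'.aestronglyMeasurable]
  rfl

theorem missProb_eq_integral_map_normalizedSynthesis (hσ : 0 < M.σ) (hQ : M.Q.PosSemidef)
    (hC₀ : M.C₀.PosSemidef) {N : ℕ} {φ : (Fin N → EuclideanSpace ℝ (Fin m)) → ℝ}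
    (hφ : Measurable φ) :
    M.missProb φ = ∫ v : ObsSpace m N, (1 - φ (M.σ • v).ofLp)
      ∂(stdGaussian _).map (M.normalizedSynthesis N) := by
  have hfirst := (firstTerms N : (ℕ → EuclideanSpace ℝ (Fin m)) →L[ℝ] _).continuous.measurable
  have hφ' : Measurable fun v : ObsSpace m N => 1 - φ v.ofLp :=
    (hφ.comp (by fun_prop)).const_sub 1
  rw [← integral_map (f := fun v : ObsSpace m N => 1 - φ v.ofLp)
    (measurable_const_smul M.σ).aemeasurable hφ'.aestronglyMeasurable,
    ← map_firstTerms_lawH1 hσ hQ hC₀, integral_map hfirst.aemeasurable hφ'.aestronglyMeasurable]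
  rfl

theorem optimalMissProb_eq_leastMissProb (hσ : 0 < M.σ) (hQ : M.Q.PosSemidef)
    (hC₀ : M.C₀.PosSemidef) (α : ℝ) (N : ℕ) :
    M.optimalMissProb α N = leastMissProb (stdGaussian (ObsSpace m N))
      ((stdGaussian (ObsSpace m N)).map (M.normalizedSynthesis N)) α := by
  rw [optimalMissProb, leastMissProb]
  congr 1
  ext β
  constructor
  · rintro ⟨φ, ⟨hφ, hφ01⟩, hα, rfl⟩
    exact ⟨fun v => φ (M.σ • v).ofLp, ⟨hφ.comp (by fun_prop), fun v => hφ01 _⟩,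
      (falseAlarmProb_eq_integral_stdGaussian hφ).symm.trans_le hα,
      (missProb_eq_integral_map_normalizedSynthesis hσ hQ hC₀ hφ).symm⟩
  · rintro ⟨φ, ⟨hφ, hφ01⟩, hα, rfl⟩
    have hψ : Measurable fun y : Fin N → EuclideanSpace ℝ (Fin m) =>
        φ (WithLp.toLp 2 (M.σ⁻¹ • y)) := hφ.comp (by fun_prop)
    refine ⟨_, ⟨hψ, fun y => hφ01 _⟩, ?_, ?_⟩
    · simpa only [falseAlarmProb_eq_integral_stdGaussian hψ, WithLp.ofLp_smul,
        inv_smul_smul₀ hσ.ne'] using hα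
    · simp only [missProb_eq_integral_map_normalizedSynthesis hσ hQ hC₀ hψ, WithLp.ofLp_smul,
        inv_smul_smul₀ hσ.ne']

theorem optimalMissProb_pos (hσ : 0 < M.σ) (hQ : M.Q.PosSemidef) (hC₀ : M.C₀.PosSemidef)
    {α : ℝ} (hα : α ∈ Set.Ioo (0 : ℝ) 1) (N : ℕ) : 0 < M.optimalMissProb α N := by
  rw [optimalMissProb_eq_leastMissProb hσ hQ hC₀]
  exact leastMissProb_pos (M.measurable_logLikelihoodRatio N)
    (stdGaussian_map_normalizedSynthesis hσ hQ hC₀ N) hα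

theorem tendsto_neg_log_optimalMissProb (hσ : 0 < M.σ) (hQ : M.Q.PosSemidef)
    (hC₀ : M.C₀.PosSemidef) {κ : ℝ}
    (hκ : Tendsto (fun i => M.errorExponent (M.riccatiSeq i) (M.nullPredictorCov i)) atTop (𝓝 κ))
    {α : ℝ} (hα : α ∈ Set.Ioo (0 : ℝ) 1) :
    Tendsto (fun N : ℕ => -(1 / (N : ℝ)) * Real.log (M.optimalMissProb α N)) atTop (𝓝 κ) := by
  have hmean : Tendsto (fun N : ℕ => (N : ℝ)⁻¹
      * ∫ v, M.logLikelihoodRatio N v ∂stdGaussian (ObsSpace m N)) atTop (𝓝 κ) := by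
    simpa only [integral_logLikelihoodRatio hσ hQ hC₀] using hκ.cesaro
  simp only [optimalMissProb_eq_leastMissProb hσ hQ hC₀]
  exact tendsto_neg_log_leastMissProb M.measurable_logLikelihoodRatio
    (stdGaussian_map_normalizedSynthesis hσ hQ hC₀)
    (fun ε => tendsto_measureReal_mul_le_abs_sub memLp_logLikelihoodRatio hmean
      (variance_logLikelihoodRatio_le hσ hQ hC₀)) hα

end VectorModel

end

theorem mainTheorem2 {m p : ℕ} (M : VectorModel m p)
    (hσ : 0 < M.σ) (hQ : M.Q.PosSemidef)
    (hA : IsStableMatrix M.A)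
    (hC₀ : M.C₀.PosSemidef)
    (hstat : M.C₀ = M.A * M.C₀ * M.A.transpose + M.B * M.Q * M.B.transpose) :
    ∃ P P' : Matrix (Fin m) (Fin m) ℝ,
      -- `P` is the unique stabilizing solution of the Riccati equation
      (M.IsStabilizingSolution P ∧ ∀ X, M.IsStabilizingSolution X → X = P) ∧
      P.PosSemidef ∧
      -- `P'` is the unique positive semidefinite solution of the Lyapunov equation
      (M.IsLyapunovSolution P P' ∧ ∀ X, M.IsLyapunovSolution P X → X = P') ∧
      -- the steady-state innovation covariances under `H₁` and `H₀`
      Tendsto (fun i => M.innovationCov M.lawH1 i) atTop (𝓝 (M.Re P)) ∧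
      Tendsto (fun i => M.innovationCov M.lawH0 i) atTop (𝓝 (M.ReTilde P')) ∧
      -- the best error exponent of the miss probability, for every level
      ∀ α ∈ Set.Ioo (0 : ℝ) 1,
        (∀ N, 0 < M.optimalMissProb α N) ∧
        Tendsto (fun N : ℕ => -(1 / (N : ℝ)) * Real.log (M.optimalMissProb α N)) atTop
          (𝓝 (M.errorExponent P P')) := by
  obtain ⟨P, hlim, hP, hfix⟩ := VectorModel.exists_tendsto_riccatiSeq hσ hQ hC₀ hstat
  have hsol := VectorModel.isStabilizingSolution_of_posSemidef hσ hQ hA hP hfix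
  obtain ⟨P', hP'⟩ := VectorModel.exists_isLyapunovSolution hsol.stable
  have hnull := VectorModel.tendsto_nullPredictorCov hsol.isUnit_det hlim hsol.stable hP'
  have hexponent := VectorModel.tendsto_errorExponent hσ hP hlim hsol.stable hP'
  refine ⟨P, P', ⟨hsol, fun X hX => hsol.eq hX⟩, hP,
    ⟨hP', fun X hX => hP'.eq hsol.stable hX⟩, ?_, ?_,
    fun α hα => ⟨VectorModel.optimalMissProb_pos hσ hQ hC₀ hα,
      VectorModel.tendsto_neg_log_optimalMissProb hσ hQ hC₀ hexponent hα⟩⟩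
  · simp_rw [VectorModel.innovationCov_lawH1 hσ hQ hC₀]
    exact hlim.const_add _
  · simp_rw [VectorModel.innovationCov_lawH0 hσ hQ hC₀]
    exact (hnull.const_add 1).const_smul _
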